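/- Let $G$ be a (finite-dimensional, Hausdorff, smooth) connected real Lie group with identity $e$. A smooth vector field on $G$ is called linear if it has a global flow consisting of Lie group automorphisms of $G$. Let $\mathcal X_0,\mathcal X_1,\dots,\mathcal X_m$ be linear vector fields on $G$ with $[\mathcal X_i,\mathcal X_j]=0$ for all $i,j=0,\dots,m$, with flows $\varphi^0_t,\dots,\varphi^m_t$, and let $Y_0,Y_1,\dots,Y_m$ be right invariant vector fields on $G$. Put $$\rho(t_0,t_1,\dots,t_m)=\varphi^0_{t_0}\circ\varphi^1_{t_1}\circ\cdots\circ\varphi^m_{t_m},$$ and consider the affine control system $$\frac{dg}{dt}=(\mathcal X_0+Y_0)(g)+\sum_{j=1}^m u_j(\mathcal X_j+Y_j)(g).$$ For a control $u:\mathbb R\to\mathbb R^m$, a solution on an interval $J$ is a continuous curve in $G$ that is locally absolutely continuous on $J$ and satisfies the equation at almost every time of $J$. (a) For every constant control $u=(u_1,\dots,u_m)\in\mathbb R^m$ and every $g\in G$, there is a solution $t\mapsto\phi_t(g,u)$ with $\phi_0(g,u)=g$ that is defined and differentiable for all $t\in\mathbb R$ and satisfies the equation at every time; every solution for $u$ on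 an interval containing $0$ that takes the value $g$ at time $0$ agrees with it on that interval; and for all $t\in\mathbb R$ $$\phi_t(g,u)=\phi_t(e,u)\cdot\rho(t,u_1t,\dots,u_mt)(g).$$ (b) Let $u:\mathbb R\to\mathbb R^m$ be a piecewise constant control, that is, constant between switching times of which there are only finitely many in every bounded interval. For every $g\in G$ there is exactly one solution $\gamma$ on $\mathbb R$ with $\gamma(0)=g$. (c) Let $u:\mathbb R\to\mathbb R^m$ be any control and $\gamma$ a solution for $u$ on an interval containing the closed interval with endpoints $a$ and $t$. If $u$ is equal to a constant $v=(v_1,\dots,v_m)$ on the open interval with these endpoints, then $$\gamma(t)=\phi_{t-a}(\gamma(a),v)=\phi_{t-a}(e,v)\cdot\rho\bigl(t-a,v_1(t-a),\dots,v_m(t-a)\bigr)(\gamma(a)).$$ In particular, if $u$ equals $u_1$ on $[0,t)$ and $u_2$ on $[t,t+s)$ with $t,s\ge 0$, the solution from $g$ is at time $t+s$ equal to $\phi_s(e,u_2)\cdot\rho(s(1,u_2))(\phi_t(g,u_1))$. -/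

import Mathlib

open Set MeasureTheory
open scoped Manifold ContDiff

noncomputable section

namespace AffineControl

section

variable {E : Type*} [NormedAddCommGroup E] [NormedSpace ℝ E]
  {H : Type*} [TopologicalSpace H] (I : ModelWithCorners ℝ E H)
  {G : Type*} [TopologicalSpace G] [ChartedSpace H G]

/-- `φ` is the (global) flow of the vector field `X`: for every `g`, the curve `t ↦ φ t g` is the
integral curve of `X` that starts at `g`. -/
structure IsFlow (X : (g : G) → TangentSpace I g) (φ : ℝ → G → G) : Prop where
  map_zero : ∀ g, φ 0 g = g
  isMIntegralCurve : ∀ g, IsMIntegralCurve (I := I) (fun t => φ t g) X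

/-- A smooth vector field on a Lie group is linear if its flow consists of automorphisms of the
Lie group. -/
structure IsLinearVectorField [Group G] [LieGroup I ∞ G]
    (X : (g : G) → TangentSpace I g) : Prop where
  contMDiff : ContMDiff I I.tangent ∞ (fun g => (⟨g, X g⟩ : TangentBundle I G))
  exists_flow : ∃ φ : ℝ → G ≃* G,
    IsFlow I X (fun t g => φ t g) ∧ ∀ t, ContMDiff I I ∞ (fun g => φ t g)

/-- A vector field `Y` on a Lie group is right invariant if `d(R_h)_g (Y g) = Y (g h)`. -/
def IsRightInvariant [Group G] (Y : (g : G) → TangentSpace I g) : Prop :=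
  ∀ g h : G, mfderiv I I (fun x : G => x * h) g (Y g) = Y (g * h)

variable {I} in
/-- The right-hand side `(X₀ + Y₀)(g) + ∑ j, v j (X_j + Y_j)(g)` of the affine system, for the
control value `v`. -/
def affineField {m : ℕ} (X Y : Fin (m + 1) → (g : G) → TangentSpace I g) (v : Fin m → ℝ) (g : G) :
    TangentSpace I g :=
  (X 0 g + Y 0 g) + ∑ j : Fin m, v j • (X j.succ g + Y j.succ g)

variable {I} in
/-- `γ` solves the affine system with control `u` on the time interval `J`, in the sense of
Carathéodory: it is continuous, locally absolutely continuous (tested on smooth real functions),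
and satisfies the differential equation at almost every time. -/
structure IsSolutionOn {m : ℕ} (X Y : Fin (m + 1) → (g : G) → TangentSpace I g)
    (u : ℝ → Fin m → ℝ) (γ : ℝ → G) (J : Set ℝ) : Prop where
  continuousOn : ContinuousOn γ J
  absolutelyContinuous : ∀ f : G → ℝ, ContMDiff I 𝓘(ℝ, ℝ) ∞ f →
    ∀ a b : ℝ, uIcc a b ⊆ J → AbsolutelyContinuousOnInterval (fun t => f (γ t)) a b
  hasDeriv : ∀ᵐ t : ℝ, t ∈ interior J →
    HasMFDerivAt 𝓘(ℝ, ℝ) I γ t ((1 : ℝ →L[ℝ] ℝ).smulRight (affineField X Y (u t) (γ t)))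

end

/-- `rho φ (t₀, …, t_m) = φ⁰_{t₀} ∘ φ¹_{t₁} ∘ ⋯ ∘ φᵐ_{t_m}`. -/
def rho {G : Type*} {m : ℕ} (φ : Fin (m + 1) → ℝ → G → G) (t : Fin (m + 1) → ℝ) : G → G :=
  (List.ofFn fun i => φ i (t i)).foldr (fun f h => f ∘ h) id

/-- The vector `(t, v₁ t, …, v_m t)`. -/
def timeVec {m : ℕ} (v : Fin m → ℝ) (t : ℝ) : Fin (m + 1) → ℝ :=
  Fin.cons t (fun j => v j * t)

/-- Piecewise constant controls: off a set of switching times that is finite in every bounded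
interval, `u` is constant between the switching times. -/
def IsPiecewiseConstant {m : ℕ} (u : ℝ → Fin m → ℝ) : Prop :=
  ∃ S : Set ℝ, (∀ a b : ℝ, (S ∩ Icc a b).Finite) ∧
    ∀ a b : ℝ, Disjoint (Ioo a b) S → ∃ v : Fin m → ℝ, ∀ r ∈ Ioo a b, u r = v

end AffineControl

end

noncomputable section

open Filter Topology Metric

namespace AffineControl

section Chart

variable {E : Type*} [NormedAddCommGroup E] [NormedSpace ℝ E]
  {H : Type*} [TopologicalSpace H] {I : ModelWithCorners ℝ E H}
  {M : Type*} [TopologicalSpace M] [ChartedSpace H M]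

section
variable [IsManifold I 1 M]

/-- The coordinate expression of the vector field `X` in the chart at `p`. -/
def chartField (p : M) (X : (x : M) → TangentSpace I x) (y : E) : E :=
  tangentCoordChange I ((extChartAt I p).symm y) p ((extChartAt I p).symm y)
    (X ((extChartAt I p).symm y))

lemma chartField_self (p : M) (X : (x : M) → TangentSpace I x) :
    chartField p X (extChartAt I p p) = X p := by
  unfold chartField
  rw [extChartAt_to_inv p]
  exact tangentCoordChange_self (mem_extChartAt_source p)

lemma chartField_extChartAt (p : M) (X : (x : M) → TangentSpace I x) {q : M}
    (hq : q ∈ (chartAt H p).source) :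
    chartField p X (extChartAt I p q) = tangentCoordChange I q p q (X q) := by
  unfold chartField
  rw [(extChartAt I p).left_inv (by rwa [extChartAt_source])]

lemma contDiffAt_chartField [I.Boundaryless] {n : WithTop ℕ∞} {p : M}
    {X : (x : M) → TangentSpace I x}
    (hX : ContMDiffAt I I.tangent n (fun x => (⟨x, X x⟩ : TangentBundle I M)) p) :
    ContDiffAt ℝ n (chartField p X) (extChartAt I p p) := by
  rw [contMDiffAt_iff] at hX
  have h := (hX.2.contDiffAt (by simp [I.range_eq_univ])).snd
  exact h

lemma hasDerivAt_extChartAt_comp {γ : ℝ → M} {t : ℝ} {p : M} {v : TangentSpace I (γ t)}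
    (h : HasMFDerivAt 𝓘(ℝ, ℝ) I γ t ((1 : ℝ →L[ℝ] ℝ).smulRight v))
    (hsrc : γ t ∈ (chartAt H p).source) :
    HasDerivAt (extChartAt I p ∘ γ) (tangentCoordChange I (γ t) p (γ t) v) t := by
  have h1 := HasMFDerivAt.comp t (hasMFDerivAt_extChartAt (I := I) hsrc) h
  rw [mfderiv_chartAt_eq_tangentCoordChange hsrc] at h1
  have h2 : HasFDerivAt (extChartAt I p ∘ γ)
      ((tangentCoordChange I (γ t) p (γ t)).comp ((1 : ℝ →L[ℝ] ℝ).smulRight (v : E)) : ℝ →L[ℝ] E)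
      t := h1.hasFDerivAt
  have h3 := h2.hasDerivAt
  have e : ((tangentCoordChange I (γ t) p (γ t)).comp ((1 : ℝ →L[ℝ] ℝ).smulRight (v : E))
      : ℝ →L[ℝ] E) 1 = tangentCoordChange I (γ t) p (γ t) v :=
    congrArg (tangentCoordChange I (γ t) p (γ t)) (one_smul ℝ (v : E))
  exact e ▸ h3

lemma hasMFDerivAt_of_extChartAt_comp [I.Boundaryless] {γ : ℝ → M} {t : ℝ}
    {p : M} {v : TangentSpace I (γ t)} (hc : ContinuousAt γ t)
    (hsrc : γ t ∈ (chartAt H p).source)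
    (h : HasDerivAt (extChartAt I p ∘ γ) (tangentCoordChange I (γ t) p (γ t) v) t) :
    HasMFDerivAt 𝓘(ℝ, ℝ) I γ t ((1 : ℝ →L[ℝ] ℝ).smulRight v) := by
  obtain ⟨w, hw⟩ : ∃ w : E, w = v := ⟨v, rfl⟩
  rw [← extChartAt_source I] at hsrc
  have hself := mem_extChartAt_source (I := I) (γ t)
  have key : HasDerivAt (extChartAt I (γ t) ∘ γ) w t := by
    have h0 : HasDerivAt (extChartAt I p ∘ γ) (tangentCoordChange I (γ t) p (γ t) w) t := hw ▸ h
    have h1 : HasFDerivAt (extChartAt I (γ t) ∘ (extChartAt I p).symm)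
        (tangentCoordChange I p (γ t) (γ t)) ((extChartAt I p ∘ γ) t) :=
      (hasFDerivWithinAt_tangentCoordChange (I := I) ⟨hsrc, hself⟩).hasFDerivAt
        (by simp [I.range_eq_univ])
    have h2 := h1.comp_hasDerivAt t h0
    rw [tangentCoordChange_comp (I := I) ⟨⟨hself, hsrc⟩, hself⟩,
      tangentCoordChange_self (I := I) hself] at h2
    refine h2.congr_of_eventuallyEq ?_
    filter_upwards [hc.preimage_mem_nhds ((isOpen_extChartAt_source (I := I) p).mem_nhds hsrc)]
      with s hs
    exact congrArg (extChartAt I (γ t)) ((extChartAt I p).left_inv hs).symm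
  have h2 : HasFDerivAt (extChartAt I (γ t) ∘ γ) ((1 : ℝ →L[ℝ] ℝ).smulRight w) t := by
    rw [ContinuousLinearMap.smulRight_one_eq_toSpanSingleton]
    exact key.hasFDerivAt
  have h3 := h2.hasFDerivWithinAt (s := univ)
  subst hw
  refine ⟨hc, ?_⟩
  simpa only [mfld_simps] using! h3

end
end Chart

section LocalFlow

variable {E : Type*} [NormedAddCommGroup E] [NormedSpace ℝ E] [CompleteSpace E]
  {H : Type*} [TopologicalSpace H] {I : ModelWithCorners ℝ E H} [I.Boundaryless]
  {M : Type*} [TopologicalSpace M] [ChartedSpace H M] [IsManifold I 1 M] [T2Space M]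

/-- A global flow of a `C¹` vector field, read in the chart at `p`, stays for short times near the
base point and is Lipschitz in the initial value, uniformly in time. -/
lemma IsFlow.exists_chart_lipschitz {X : (x : M) → TangentSpace I x} {φ : ℝ → M → M}
    (hφ : IsFlow I X φ)
    (hX : ContMDiff I I.tangent 1 (fun x => (⟨x, X x⟩ : TangentBundle I M))) (p : M)
    {U : Set E} (hU : U ∈ 𝓝 (extChartAt I p p)) :
    ∃ r > 0, ∃ ε > 0, ∃ L : NNReal,
      ball (extChartAt I p p) r ⊆ (extChartAt I p).target ∧
      (∀ x ∈ ball (extChartAt I p p) r, ∀ t ∈ Ioo (-ε) ε,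
        φ t ((extChartAt I p).symm x) ∈ (chartAt H p).source ∧
        extChartAt I p (φ t ((extChartAt I p).symm x)) ∈ U) ∧
      ∀ t ∈ Ioo (-ε) ε, LipschitzOnWith L
        (fun x => extChartAt I p (φ t ((extChartAt I p).symm x))) (ball (extChartAt I p p) r) := by
  set x₀ := extChartAt I p p with hx₀
  set V := U ∩ (extChartAt I p).target
  have hV : V ∈ 𝓝 x₀ := inter_mem hU (extChartAt_target_mem_nhds p)
  obtain ⟨ε₁, hε₁, a, r₁, K, k, hr₁, hPL⟩ :=
    IsPicardLindelof.of_contDiffAt_one (contDiffAt_chartField (hX p))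
  have hr₁' : (0 : ℝ) < r₁ := hr₁
  obtain ⟨α, hα, L, hL⟩ :=
    (hPL 0).exists_forall_mem_closedBall_eq_hasDerivWithinAt_lipschitzOnWith
  have h0 : x₀ ∈ closedBall x₀ (r₁ : ℝ) := mem_closedBall_self hr₁'.le
  obtain ⟨ρ, hρ, hρV⟩ := Metric.mem_nhds_iff.1 hV
  -- for small times and nearby initial points the local solutions stay in `V`
  have hcont : ContinuousAt (α x₀) 0 :=
    ((hα x₀ h0).2 0 (by constructor <;> linarith)).continuousWithinAt.continuousAt
      (Icc_mem_nhds (by linarith) (by linarith))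
  obtain ⟨δ, hδ, hδ'⟩ := Metric.continuousAt_iff.1 hcont (ρ / 2) (by positivity)
  set ε := min ε₁ δ
  set r := min (r₁ : ℝ) (ρ / (2 * (L + 1)))
  have hε : 0 < ε := lt_min hε₁ hδ
  have hr : 0 < r := lt_min hr₁' (by positivity)
  have hIoo : ∀ t ∈ Ioo (-ε) ε, t ∈ Ioo (0 - ε₁) (0 + ε₁) ∧ |t| < δ := by
    intro t ht
    have h1 : ε ≤ ε₁ := min_le_left _ _
    have h2 : ε ≤ δ := min_le_right _ _
    refine ⟨⟨by linarith [ht.1], by linarith [ht.2]⟩,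
      abs_lt.2 ⟨by linarith [ht.1], by linarith [ht.2]⟩⟩
  have hball : ∀ x ∈ ball x₀ r, x ∈ closedBall x₀ (r₁ : ℝ) := fun x hx =>
    ball_subset_closedBall (ball_subset_ball (min_le_left _ _) hx)
  have hmem : ∀ x ∈ ball x₀ r, ∀ t ∈ Ioo (-ε) ε, α x t ∈ V := by
    intro x hx t ht
    obtain ⟨ht1, ht2⟩ := hIoo t ht
    apply hρV
    have h1 : dist (α x t) (α x₀ t) ≤ L * dist x x₀ :=
      (hL t (Ioo_subset_Icc_self ht1)).dist_le_mul x (hball x hx) x₀ h0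
    have h2 : dist (α x₀ t) (α x₀ 0) < ρ / 2 := hδ' (by simpa [Real.dist_eq] using ht2)
    rw [(hα x₀ h0).1] at h2
    have h3 : L * dist x x₀ ≤ ρ / 2 := by
      have h4 : dist x x₀ ≤ ρ / (2 * (L + 1)) := (mem_ball.1 hx).le.trans (min_le_right _ _)
      have h5 : (0 : ℝ) ≤ L := L.2
      rw [le_div_iff₀ (by positivity)] at h4
      nlinarith [dist_nonneg (x := x) (y := x₀)]
    exact mem_ball.2 ((dist_triangle _ _ _).trans_lt (by linarith))
  have hsymm : ∀ x ∈ ball x₀ r, ∀ t ∈ Ioo (-ε) ε,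
      φ t ((extChartAt I p).symm x) = (extChartAt I p).symm (α x t) := by
    intro x hx
    have hcurve : IsMIntegralCurveOn (I := I) (fun t => (extChartAt I p).symm (α x t)) X
        (Ioo (-ε) ε) := by
      intro t ht
      have htar := (hmem x hx t ht).2
      have hd := ((hα x (hball x hx)).2 t (Ioo_subset_Icc_self (hIoo t ht).1)).hasDerivAt
        (Icc_mem_nhds (hIoo t ht).1.1 (hIoo t ht).1.2)
      refine HasMFDerivAt.hasMFDerivWithinAt (hasMFDerivAt_of_extChartAt_comp (p := p) ?_ ?_ ?_)
      · exact (continuousAt_extChartAt_symm'' htar).comp hd.continuousAt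
      · rw [← extChartAt_source I]
        exact (extChartAt I p).map_target htar
      · refine HasDerivAt.congr_of_eventuallyEq (f := α x) hd ?_
        filter_upwards [Ioo_mem_nhds ht.1 ht.2] with s hs
        exact (extChartAt I p).right_inv (hmem x hx s hs).2
    have hz : (0 : ℝ) ∈ Ioo (-ε) ε := by constructor <;> linarith
    refine isMIntegralCurveOn_Ioo_eqOn_of_contMDiff_boundaryless hz hX
      ((hφ.isMIntegralCurve _).isMIntegralCurveOn _) hcurve ?_
    rw [hφ.map_zero, (hα x (hball x hx)).1]
  refine ⟨r, hr, ε, hε, L, ?_, ?_, ?_⟩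
  · intro x hx
    have := (hmem x hx 0 (by constructor <;> linarith)).2
    rwa [(hα x (hball x hx)).1] at this
  · intro x hx t ht
    have := hmem x hx t ht
    rw [hsymm x hx t ht, ← extChartAt_source I, (extChartAt I p).right_inv this.2]
    exact ⟨(extChartAt I p).map_target this.2, this.1⟩
  · intro t ht
    refine LipschitzOnWith.of_dist_le_mul fun x hx y hy => ?_
    rw [hsymm x hx t ht, hsymm y hy t ht, (extChartAt I p).right_inv (hmem x hx t ht).2,
      (extChartAt I p).right_inv (hmem y hy t ht).2]
    exact (hL t (Ioo_subset_Icc_self (hIoo t ht).1)).dist_le_mul x (hball x hx) y (hball y hy)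

end LocalFlow

section LocalFlow

variable {E : Type*} [NormedAddCommGroup E] [NormedSpace ℝ E]
  {H : Type*} [TopologicalSpace H] {I : ModelWithCorners ℝ E H}
  {M : Type*} [TopologicalSpace M] [ChartedSpace H M] [IsManifold I 1 M]

lemma IsFlow.hasDerivAt_chart {X : (x : M) → TangentSpace I x} {φ : ℝ → M → M}
    (hφ : IsFlow I X φ) {p q : M} {t : ℝ} (h : φ t q ∈ (chartAt H p).source) :
    HasDerivAt (fun s => extChartAt I p (φ s q)) (chartField p X (extChartAt I p (φ t q))) t := by
  rw [chartField_extChartAt p X h]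
  exact hasDerivAt_extChartAt_comp (hφ.isMIntegralCurve q t) h

variable [I.Boundaryless] [T2Space M]

lemma IsFlow.eventually_norm_sub_le [CompleteSpace E]
    {X : (x : M) → TangentSpace I x} {φ : ℝ → M → M}
    (hφ : IsFlow I X φ)
    (hX : ContMDiff I I.tangent 1 (fun x => (⟨x, X x⟩ : TangentBundle I M))) (p : M)
    {η : ℝ} (hη : 0 < η) :
    ∀ᶠ q : E × ℝ in 𝓝 (extChartAt I p p, 0),
      φ q.2 ((extChartAt I p).symm q.1) ∈ (chartAt H p).source ∧
      ‖extChartAt I p (φ q.2 ((extChartAt I p).symm q.1)) - q.1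
        - q.2 • chartField p X (extChartAt I p p)‖ ≤ η * |q.2| := by
  set x₀ := extChartAt I p p
  set f := chartField p X
  have hf : ContinuousAt f x₀ := (contDiffAt_chartField (hX p)).continuousAt
  have hU : {u | ‖f u - f x₀‖ ≤ η} ∈ 𝓝 x₀ := by
    filter_upwards [Metric.continuousAt_iff'.1 hf η hη] with u hu
    exact (dist_eq_norm (f u) (f x₀) ▸ hu).le
  obtain ⟨r, hr, ε, hε, L, htar, hsrc, -⟩ := hφ.exists_chart_lipschitz hX p hU
  filter_upwards [prod_mem_nhds (ball_mem_nhds x₀ hr)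
    (Ioo_mem_nhds (neg_lt_zero.2 hε) hε)] with q hq
  obtain ⟨hx, ht⟩ := hq
  refine ⟨(hsrc _ hx _ ht).1, ?_⟩
  have hd : ∀ s ∈ Ioo (-ε) ε, HasDerivWithinAt
      (fun s => extChartAt I p (φ s ((extChartAt I p).symm q.1)) - s • f x₀)
      (f (extChartAt I p (φ s ((extChartAt I p).symm q.1))) - f x₀) (Ioo (-ε) ε) s := by
    intro s hs
    have h1 := (hφ.hasDerivAt_chart (hsrc _ hx s hs).1).sub ((hasDerivAt_id s).smul_const (f x₀))
    rw [one_smul] at h1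
    exact h1.hasDerivWithinAt
  have := (convex_Ioo (-ε) ε).norm_image_sub_le_of_norm_hasDerivWithin_le hd
    (fun s hs => (hsrc _ hx s hs).2) (x := 0) (y := q.2) ⟨by linarith, hε⟩ ht
  simp only [hφ.map_zero, zero_smul, sub_zero, Real.norm_eq_abs] at this
  rw [(extChartAt I p).right_inv (htar hx)] at this
  convert this using 2
  abel

/-- The derivative at time zero of a moving point transported by a flow. -/
lemma IsFlow.hasDerivAt_chart_comp [CompleteSpace E]
    {X : (x : M) → TangentSpace I x} {φ : ℝ → M → M}
    (hφ : IsFlow I X φ)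
    (hX : ContMDiff I I.tangent 1 (fun x => (⟨x, X x⟩ : TangentBundle I M))) {p : M}
    {c : ℝ → M} (hc0 : c 0 = p) (hc : ContinuousAt c 0) {w : E}
    (hw : HasDerivAt (extChartAt I p ∘ c) w 0) :
    (∀ᶠ t in 𝓝 0, φ t (c t) ∈ (chartAt H p).source) ∧
    HasDerivAt (fun t => extChartAt I p (φ t (c t)))
      (w + chartField p X (extChartAt I p p)) 0 := by
  set x₀ := extChartAt I p p
  set f := chartField p X
  set z := extChartAt I p ∘ c
  have hz0 : z 0 = x₀ := congrArg (extChartAt I p) hc0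
  have hcs : ∀ᶠ t in 𝓝 0, (extChartAt I p).symm (z t) = c t := by
    have : (extChartAt I p).source ∈ 𝓝 (c 0) := hc0 ▸ extChartAt_source_mem_nhds p
    filter_upwards [hc.preimage_mem_nhds this] with t ht
    exact (extChartAt I p).left_inv ht
  have hlim : Tendsto (fun t => (z t, t)) (𝓝 0) (𝓝 (x₀, 0)) := by
    have := hw.continuousAt.tendsto
    rw [hz0] at this
    exact this.prodMk_nhds tendsto_id
  constructor
  · filter_upwards [hlim.eventually (hφ.eventually_norm_sub_le hX p one_pos), hcs] with t ht hct
    rw [← hct]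
    exact ht.1
  · have h1 : HasDerivAt (fun t => extChartAt I p (φ t (c t)) - z t) (f x₀) 0 := by
      rw [hasDerivAt_iff_isLittleO, Asymptotics.isLittleO_iff]
      intro η hη
      filter_upwards [hlim.eventually (hφ.eventually_norm_sub_le hX p hη), hcs] with t ht hct
      rw [hφ.map_zero]
      have := ht.2
      rw [hct] at this
      rw [show extChartAt I p (c 0) - z 0 = 0 from sub_self _, sub_zero, sub_zero,
        Real.norm_eq_abs]
      exact this
    have h2 := hw.add h1
    refine h2.congr_of_eventuallyEq (Eventually.of_forall fun t => ?_)
    simp [z]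

lemma gronwallBound_zero_left (K ε t : ℝ) :
    gronwallBound 0 K ε t = ε * gronwallBound 0 K 1 t := by
  unfold gronwallBound
  split_ifs <;> ring

lemma gronwallBound_zero_one_nonneg {K t : ℝ} (hK : 0 ≤ K) (ht : 0 ≤ t) :
    0 ≤ gronwallBound 0 K 1 t := by
  unfold gronwallBound
  split_ifs
  · simpa using ht
  · have : 1 ≤ Real.exp (K * t) := Real.one_le_exp (mul_nonneg hK ht)
    have : 0 ≤ 1 / K * (Real.exp (K * t) - 1) := mul_nonneg (by positivity) (by linarith)
    simpa using this

lemma IsFlow.map_eq_of_eq_zero {X : (x : M) → TangentSpace I x} {φ : ℝ → M → M}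
    (hφ : IsFlow I X φ)
    (hX : ContMDiff I I.tangent 1 (fun x => (⟨x, X x⟩ : TangentBundle I M))) {p : M}
    (hp : X p = 0) (t : ℝ) : φ t p = p :=
  congrFun (isMIntegralCurve_Ioo_eq_of_contMDiff_boundaryless (t₀ := 0) hX
    (hφ.isMIntegralCurve p) (isMIntegralCurve_const hp) (hφ.map_zero p)) t

/-- The linearization of a flow at a fixed point is the exponential of the linearization of the
vector field. -/
lemma IsFlow.hasFDerivAt_exp [CompleteSpace E]
    {X : (x : M) → TangentSpace I x} {φ : ℝ → M → M}
    (hφ : IsFlow I X φ)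
    (hX : ContMDiff I I.tangent 1 (fun x => (⟨x, X x⟩ : TangentBundle I M))) {p : M}
    (hp : X p = 0) :
    ∃ ε > 0, ∀ t ∈ Ico 0 ε, HasFDerivAt
      (fun x => extChartAt I p (φ t ((extChartAt I p).symm x)))
      (NormedSpace.exp (t • fderiv ℝ (chartField p X) (extChartAt I p p))) (extChartAt I p p) := by
  set x₀ := extChartAt I p p with hx₀
  set f := chartField p X
  set D := fderiv ℝ f x₀
  have hf0 : f x₀ = 0 := (chartField_self p X).trans hp
  have hfd : HasFDerivAt f D x₀ :=
    ((contDiffAt_chartField (hX p)).differentiableAt (by norm_num)).hasFDerivAt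
  obtain ⟨r, hr, ε, hε, L, htar, hsrc, hLip⟩ := hφ.exists_chart_lipschitz hX p univ_mem
  refine ⟨ε, hε, fun t ht => ?_⟩
  set y : E → ℝ → E := fun x s => extChartAt I p (φ s ((extChartAt I p).symm x))
  have hyx₀ : ∀ s, y x₀ s = x₀ := by
    intro s
    simp only [y, hx₀]
    rw [extChartAt_to_inv, hφ.map_eq_of_eq_zero hX hp]
  set C := gronwallBound 0 ‖D‖ 1 t
  have hC : 0 ≤ C := gronwallBound_zero_one_nonneg (norm_nonneg _) ht.1
  rw [hasFDerivAt_iff_isLittleO, Asymptotics.isLittleO_iff]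
  intro c hc
  set η := c / (L * C + 1)
  have hη : 0 < η := by positivity
  have hlin := Asymptotics.isLittleO_iff.1 (hasFDerivAt_iff_isLittleO.1 hfd) hη
  obtain ⟨ρ, hρ, hρ'⟩ := Metric.eventually_nhds_iff.1 hlin
  filter_upwards [ball_mem_nhds x₀ (lt_min hr (show 0 < ρ / (L + 1) by positivity))] with x hx
  have hxr : x ∈ ball x₀ r := ball_subset_ball (min_le_left _ _) hx
  have hxρ : dist x x₀ < ρ / (L + 1) := (mem_ball.1 hx).trans_le (min_le_right _ _)
  have hsub : ∀ s ∈ Icc 0 t, s ∈ Ioo (-ε) ε := fun s hs =>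
    ⟨by linarith [hs.1], by linarith [hs.2, ht.2]⟩
  have hdist : ∀ s ∈ Icc 0 t, dist (y x s) x₀ ≤ L * dist x x₀ := by
    intro s hs
    have := (hLip s (hsub s hs)).dist_le_mul x hxr x₀ (mem_ball_self hr)
    change dist (y x s) (y x₀ s) ≤ _ at this
    rwa [hyx₀] at this
  have hg : ∀ s ∈ Icc 0 t, HasDerivAt
      (fun s => y x s - x₀ - NormedSpace.exp (s • D) (x - x₀))
      (f (y x s) - D (NormedSpace.exp (s • D) (x - x₀))) s := by
    intro s hs
    have h1 := (hφ.hasDerivAt_chart (hsrc _ hxr s (hsub s hs)).1).sub_const x₀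
    have h2 := (hasDerivAt_exp_smul_const' D s).clm_apply (hasDerivAt_const s (x - x₀))
    rw [_root_.map_zero, add_zero] at h2
    exact h1.sub h2
  have hbound : ∀ s ∈ Ico 0 t, ‖f (y x s) - D (NormedSpace.exp (s • D) (x - x₀))‖ ≤
      ‖D‖ * ‖y x s - x₀ - NormedSpace.exp (s • D) (x - x₀)‖ + η * (L * ‖x - x₀‖) := by
    intro s hs
    have h1 : f (y x s) - D (NormedSpace.exp (s • D) (x - x₀)) =
        D (y x s - x₀ - NormedSpace.exp (s • D) (x - x₀)) +
          (f (y x s) - f x₀ - D (y x s - x₀)) := by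
      rw [hf0, map_sub D (y x s - x₀)]
      abel
    have hd := hdist s (Ico_subset_Icc_self hs)
    have h2 : dist (y x s) x₀ < ρ := by
      refine hd.trans_lt ?_
      rw [lt_div_iff₀ (by positivity)] at hxρ
      nlinarith [dist_nonneg (x := x) (y := x₀)]
    have h3 := hρ' h2
    rw [h1]
    refine (norm_add_le _ _).trans (add_le_add (D.le_opNorm _) (h3.trans ?_))
    rw [← dist_eq_norm, ← dist_eq_norm]
    gcongr
  have hinit : ‖y x 0 - x₀ - NormedSpace.exp ((0 : ℝ) • D) (x - x₀)‖ ≤ 0 := by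
    simp only [y]
    rw [hφ.map_zero, (extChartAt I p).right_inv (htar hxr)]
    simp
  have := norm_le_gronwallBound_of_norm_deriv_right_le
    (fun s hs => (hg s hs).continuousAt.continuousWithinAt)
    (fun s hs => (hg s (Ico_subset_Icc_self hs)).hasDerivWithinAt) (δ := 0)
    hinit hbound t ⟨ht.1, le_rfl⟩
  rw [gronwallBound_zero_left, sub_zero] at this
  change ‖y x t - y x₀ t - _‖ ≤ _
  rw [hyx₀]
  refine this.trans ?_
  have h5 : η * (L * C) ≤ c := by
    have : η * (L * C + 1) = c := div_mul_cancel₀ _ (by positivity)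
    nlinarith
  change η * (L * ‖x - x₀‖) * C ≤ c * ‖x - x₀‖
  nlinarith [norm_nonneg (x - x₀)]

end LocalFlow

lemma clm_comp_zero_comp {E₁ E₂ E₃ E₄ : Type*} [NormedAddCommGroup E₁] [NormedSpace ℝ E₁]
    [NormedAddCommGroup E₂] [NormedSpace ℝ E₂] [NormedAddCommGroup E₃] [NormedSpace ℝ E₃]
    [NormedAddCommGroup E₄] [NormedSpace ℝ E₄] (A : E₁ →L[ℝ] E₂) (B : E₃ →L[ℝ] E₄) :
    B.comp ((0 : E₂ →L[ℝ] E₃).comp A) = 0 := by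
  simp

section ZeroDerivative

variable {E : Type*} [NormedAddCommGroup E] [NormedSpace ℝ E]
  {H : Type*} [TopologicalSpace H] {I : ModelWithCorners ℝ E H}
  {M : Type*} [TopologicalSpace M] [ChartedSpace H M]
  {E' : Type*} [NormedAddCommGroup E'] [NormedSpace ℝ E']
  {H' : Type*} [TopologicalSpace H'] {I' : ModelWithCorners ℝ E' H'}
  {M' : Type*} [TopologicalSpace M'] [ChartedSpace H' M']

lemma hasMFDerivAt_comp_of_eq {E'' : Type*} [NormedAddCommGroup E''] [NormedSpace ℝ E'']
    {H'' : Type*} [TopologicalSpace H''] {I'' : ModelWithCorners ℝ E'' H''}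
    {M'' : Type*} [TopologicalSpace M''] [ChartedSpace H'' M'']
    {g : M' → M''} {f : M → M'} {x : M} {y : M'} (hy : f x = y) {g' : E' →L[ℝ] E''}
    {f' : E →L[ℝ] E'} (hg : HasMFDerivAt I' I'' g y g') (hf : HasMFDerivAt I I' f x f') :
    HasMFDerivAt I I'' (g ∘ f) x (g'.comp f') := by
  subst hy
  exact hg.comp x hf

lemma hasMFDerivAt_congr_deriv {f : M → M'} {x : M} {A B : E →L[ℝ] E'} (h : A = B)
    (hf : HasMFDerivAt I I' f x A) : HasMFDerivAt I I' f x B :=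
  h ▸ hf

lemma exists_hasMFDerivAt {f : M → M'} {x : M} (hf : MDifferentiableAt I I' f x) :
    ∃ A : E →L[ℝ] E', HasMFDerivAt I I' f x A :=
  ⟨_, hf.hasMFDerivAt⟩

variable [I.Boundaryless] [IsManifold I 1 M] [IsManifold I' 1 M']

lemma isLocallyConstant_of_hasMFDerivAt_zero {f : M → M'}
    (hf : ∀ x, HasMFDerivAt I I' f x 0) : IsLocallyConstant f := by
  rw [IsLocallyConstant.iff_eventually_eq]
  intro p
  set x₀ := extChartAt I p p
  set F := extChartAt I' (f p) ∘ f ∘ (extChartAt I p).symm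
  have hsymm : ContinuousAt (extChartAt I p).symm x₀ := continuousAt_extChartAt_symm p
  have h1 : ∀ᶠ y in 𝓝 x₀, f ((extChartAt I p).symm y) ∈ (extChartAt I' (f p)).source := by
    have hc : ContinuousAt (f ∘ (extChartAt I p).symm) x₀ := by
      refine ContinuousAt.comp ?_ hsymm
      exact (hf _).continuousAt
    refine hc.preimage_mem_nhds ?_
    simp only [Function.comp_apply, x₀, extChartAt_to_inv]
    exact extChartAt_source_mem_nhds (f p)
  obtain ⟨r, hr, hr'⟩ := Metric.mem_nhds_iff.1 (inter_mem h1 (extChartAt_target_mem_nhds p))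
  have hF : ∀ y ∈ ball x₀ r, HasFDerivWithinAt F (0 : E →L[ℝ] E') (ball x₀ r) y := by
    intro y hy
    obtain ⟨hy1, hy2⟩ := hr' hy
    have ha : MDifferentiableAt 𝓘(ℝ, E) I (extChartAt I p).symm y := by
      have := mdifferentiableWithinAt_extChartAt_symm (I := I) hy2
      rwa [I.range_eq_univ, mdifferentiableWithinAt_univ] at this
    obtain ⟨A, hA⟩ := exists_hasMFDerivAt ha
    obtain ⟨B, hB⟩ := exists_hasMFDerivAt
      (mdifferentiableAt_extChartAt (I := I') (x := f p) (by rwa [← extChartAt_source I']))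
    have hc := hasMFDerivAt_comp_of_eq (f := f ∘ (extChartAt I p).symm) rfl hB
      (hasMFDerivAt_comp_of_eq (g' := 0) rfl (hf _) hA)
    have hd := hasMFDerivAt_congr_deriv (clm_comp_zero_comp A B) hc
    exact HasFDerivAt.hasFDerivWithinAt hd.hasFDerivAt
  have hconst : ∀ y ∈ ball x₀ r, F y = F x₀ := by
    intro y hy
    have := (convex_ball x₀ r).norm_image_sub_le_of_norm_hasFDerivWithin_le (C := 0) hF
      (by simp) (mem_ball_self hr) hy
    rw [zero_mul, norm_le_zero_iff, sub_eq_zero] at this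
    exact this
  have hnhds : ∀ᶠ q in 𝓝 p, extChartAt I p q ∈ ball x₀ r :=
    (continuousAt_extChartAt p).preimage_mem_nhds (ball_mem_nhds x₀ hr)
  filter_upwards [hnhds, extChartAt_source_mem_nhds (I := I) p] with q hq hqs
  have h2 := hconst _ hq
  have h3 : f ((extChartAt I p).symm (extChartAt I p q)) ∈ (extChartAt I' (f p)).source :=
    (hr' hq).1
  simp only [F, x₀, Function.comp_apply] at h2
  rw [extChartAt_to_inv, (extChartAt I p).left_inv hqs] at h2
  rw [(extChartAt I p).left_inv hqs] at h3
  exact (extChartAt I' (f p)).injOn h3 (mem_extChartAt_source _) h2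

end ZeroDerivative

section LieGroup

variable {E : Type*} [NormedAddCommGroup E] [NormedSpace ℝ E]
  {H : Type*} [TopologicalSpace H] {I : ModelWithCorners ℝ E H}
  {G : Type*} [TopologicalSpace G] [ChartedSpace H G] [Group G]

/-- Two smooth endomorphisms of a connected Lie group with the same differential at the identity
are equal. -/
lemma monoidHom_eq_of_hasMFDerivAt_one [I.Boundaryless] [LieGroup I 1 G] [ConnectedSpace G]
    {α β : G →* G}
    (hβ : MDifferentiable I I β)
    {A : E →L[ℝ] E} (hA : HasMFDerivAt I I α 1 A) (hB : HasMFDerivAt I I β 1 A) : α = β := by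
  set h : G → G := fun g => α g * (β g)⁻¹
  have hmul : MDifferentiable (I.prod I) I (fun q : G × G => q.1 * q.2) :=
    (contMDiff_mul I 1).mdifferentiable (by norm_num)
  have hinv : MDifferentiable I I (fun g : G => g⁻¹) :=
    (contMDiff_inv I 1).mdifferentiable (by norm_num)
  have hone : HasMFDerivAt I I h 1 0 := by
    have h0 : HasMFDerivAt I I (fun g => β g * (β g)⁻¹) 1
        (0 : E →L[ℝ] E) := by
      have : (fun g => β g * (β g)⁻¹) = fun _ => (1 : G) := by
        ext g
        exact mul_inv_cancel _
      rw [this]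
      exact hasMFDerivAt_const (1 : G) (1 : G)
    have hi : MDifferentiableAt I I (fun g => (β g)⁻¹) 1 := (hinv _).comp _ (hβ _)
    obtain ⟨m, hm⟩ := exists_hasMFDerivAt (E := E × E) (hmul (1, 1))
    obtain ⟨B, hB'⟩ := exists_hasMFDerivAt hi
    have h1 := hasMFDerivAt_comp_of_eq (f := fun g => (α g, (β g)⁻¹)) (by simp) hm
      (hA.prodMk hB')
    have h2 := hasMFDerivAt_comp_of_eq (f := fun g => (β g, (β g)⁻¹)) (by simp) hm
      (hB.prodMk hB')
    have h3 : m.comp (A.prod B) = 0 := hasMFDerivAt_unique h2 h0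
    exact hasMFDerivAt_congr_deriv h3 h1
  have hall : ∀ g, HasMFDerivAt I I h g 0 := by
    intro g
    have heq : h = (fun x => α g * x * (β g)⁻¹) ∘ h ∘ (fun x => g⁻¹ * x) := by
      ext x
      simp [h, mul_assoc]
    have hl : MDifferentiable I I (fun x => α g * x * (β g)⁻¹) :=
      ((contMDiff_mul_right (I := I) (n := 1) (a := (β g)⁻¹)).comp
        (contMDiff_mul_left (I := I) (n := 1) (a := α g))).mdifferentiable (by norm_num)
    have hr : MDifferentiable I I (fun x => g⁻¹ * x) :=
      (contMDiff_mul_left (I := I) (n := 1) (a := g⁻¹)).mdifferentiable (by norm_num)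
    obtain ⟨A', hA'⟩ := exists_hasMFDerivAt (hr g)
    obtain ⟨B', hB'⟩ := exists_hasMFDerivAt (hl (h (g⁻¹ * g)))
    have h2 := hasMFDerivAt_comp_of_eq (f := h ∘ fun x => g⁻¹ * x) rfl hB'
      (hasMFDerivAt_comp_of_eq (f := fun x => g⁻¹ * x) (inv_mul_cancel g) (g' := 0) hone hA')
    rw [heq]
    exact hasMFDerivAt_congr_deriv (clm_comp_zero_comp A' B') h2
  have hlc := isLocallyConstant_of_hasMFDerivAt_zero hall
  ext g
  have := hlc.apply_eq_of_preconnectedSpace g 1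
  simp only [h, map_one, inv_one, mul_one] at this
  exact mul_inv_eq_one.1 this

end LieGroup

section Bracket

variable {E : Type*} [NormedAddCommGroup E] [NormedSpace ℝ E]
  {H : Type*} [TopologicalSpace H] {I : ModelWithCorners ℝ E H}
  {M : Type*} [TopologicalSpace M] [ChartedSpace H M]

/-- A map `E → E` seen as a vector field on the manifold `E`. -/
def modelField (f : E → E) (x : E) : TangentSpace 𝓘(ℝ, E) x := f x

lemma inverse_mfderiv_extChartAt_apply [IsManifold I 1 M] {p q : M}
    (hq : q ∈ (chartAt H p).source) {v : TangentSpace I q}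
    {w : TangentSpace 𝓘(ℝ, E) (extChartAt I p q)} :
    (mfderiv I 𝓘(ℝ, E) (extChartAt I p) q).inverse w = v ↔
      w = mfderiv I 𝓘(ℝ, E) (extChartAt I p) q v :=
  (isInvertible_mfderiv_extChartAt (by rwa [extChartAt_source])).inverse_apply_eq

lemma mpullback_chartField [IsManifold I 1 M] (p : M) (X : (x : M) → TangentSpace I x) {q : M}
    (hq : q ∈ (chartAt H p).source) :
    VectorField.mpullback I 𝓘(ℝ, E) (extChartAt I p) (modelField (chartField p X)) q = X q := by
  rw [VectorField.mpullback_apply, inverse_mfderiv_extChartAt_apply hq,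
    (hasMFDerivAt_extChartAt hq).mfderiv, mfderiv_chartAt_eq_tangentCoordChange hq]
  exact chartField_extChartAt p X hq

lemma lieBracket_chartField_eq_zero [IsManifold I 2 M] [IsManifold I 1 M] [CompleteSpace E] {p : M}
    {X Y : (x : M) → TangentSpace I x} {q : M}
    (hq : q ∈ (chartAt H p).source)
    (hX : ContDiffAt ℝ 1 (chartField p X) (extChartAt I p q))
    (hY : ContDiffAt ℝ 1 (chartField p Y) (extChartAt I p q))
    (hXY : VectorField.mlieBracket I X Y q = 0) :
    VectorField.lieBracket ℝ (chartField p X) (chartField p Y) (extChartAt I p q) = 0 := by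
  have hloc : ∀ Z : (x : M) → TangentSpace I x,
      VectorField.mpullback I 𝓘(ℝ, E) (extChartAt I p) (modelField (chartField p Z)) =ᶠ[𝓝 q] Z := by
    intro Z
    filter_upwards [(chartAt H p).open_source.mem_nhds hq] with x hx
    exact mpullback_chartField p Z hx
  have hmd : ∀ W : E → E, ContDiffAt ℝ 1 W (extChartAt I p q) →
      MDifferentiableAt 𝓘(ℝ, E) 𝓘(ℝ, E).tangent
        (fun x => (⟨x, modelField W x⟩ : TangentBundle 𝓘(ℝ, E) E)) (extChartAt I p q) := by
    intro W hW
    exact (contMDiffAt_vectorSpace_iff_contDiffAt.2 hW).mdifferentiableAt (by norm_num)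
  have hmin : minSmoothness ℝ 2 = 2 := minSmoothness_of_isRCLikeNormedField
  have : IsManifold I (minSmoothness ℝ 2) M := by rwa [hmin]
  have h := VectorField.mpullback_mlieBracket (I := I) (I' := 𝓘(ℝ, E)) (n := 2)
    (f := extChartAt I p) (V := modelField (chartField p X))
    (W := modelField (chartField p Y)) (x₀ := q) (hmd _ hX) (hmd _ hY)
    (contMDiffAt_extChartAt' hq) hmin.le
  rw [(hloc X).mlieBracket_vectorField_eq (hloc Y), hXY, VectorField.mpullback_apply,
    inverse_mfderiv_extChartAt_apply hq, ← VectorField.mlieBracketWithin_univ,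
    VectorField.mlieBracketWithin_eq_lieBracketWithin,
    _root_.map_zero] at h
  rw [← VectorField.lieBracketWithin_univ]
  exact h

lemma commute_fderiv_of_lieBracket_eq_zero {f g : E → E} {x : E} (hf : ContDiffAt ℝ 2 f x)
    (hg : ContDiffAt ℝ 2 g x) (hf0 : f x = 0) (hg0 : g x = 0)
    (h : ∀ᶠ y in 𝓝 x, VectorField.lieBracket ℝ f g y = 0) :
    Commute (fderiv ℝ f x) (fderiv ℝ g x) := by
  have hdiff : ∀ {k : E → E}, ContDiffAt ℝ 2 k x →
      HasFDerivAt k (fderiv ℝ k x) x ∧ DifferentiableAt ℝ (fderiv ℝ k) x := by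
    intro k hk
    refine ⟨(hk.differentiableAt (by norm_num)).hasFDerivAt, ?_⟩
    exact (hk.fderiv_right (m := 1) (by norm_num)).differentiableAt (by norm_num)
  have hprod : ∀ {k l : E → E}, ContDiffAt ℝ 2 k x → ContDiffAt ℝ 2 l x → l x = 0 →
      HasFDerivAt (fun y => fderiv ℝ k y (l y)) ((fderiv ℝ k x).comp (fderiv ℝ l x)) x := by
    intro k l hk hl hl0
    have := (hdiff hk).2.hasFDerivAt.clm_apply (hdiff hl).1
    refine this.congr_fderiv ?_
    rw [hl0, _root_.map_zero, add_zero]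
  have h1 := hprod hf hg hg0
  have h2 := hprod hg hf hf0
  refine h1.unique (h2.congr_of_eventuallyEq ?_)
  filter_upwards [h] with y hy
  exact (sub_eq_zero.1 hy).symm

lemma commute_fderiv_chartField [IsManifold I 2 M] [IsManifold I 1 M] [I.Boundaryless]
    [CompleteSpace E] {p : M} {X Y : (x : M) → TangentSpace I x}
    (hX : ContMDiff I I.tangent 2 (fun x => (⟨x, X x⟩ : TangentBundle I M)))
    (hY : ContMDiff I I.tangent 2 (fun x => (⟨x, Y x⟩ : TangentBundle I M)))
    (hX0 : X p = 0) (hY0 : Y p = 0) (hXY : ∀ q, VectorField.mlieBracket I X Y q = 0) :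
    Commute (fderiv ℝ (chartField p X) (extChartAt I p p))
      (fderiv ℝ (chartField p Y) (extChartAt I p p)) := by
  have hX2 := contDiffAt_chartField (hX p)
  have hY2 := contDiffAt_chartField (hY p)
  refine commute_fderiv_of_lieBracket_eq_zero hX2 hY2 ((chartField_self p X).trans hX0)
    ((chartField_self p Y).trans hY0) ?_
  filter_upwards [extChartAt_target_mem_nhds (I := I) p, hX2.eventually (by norm_num),
    hY2.eventually (by norm_num)] with y hy hXy hYy
  have hq := (extChartAt I p).map_target hy
  rw [extChartAt_source] at hq
  have hy' := (extChartAt I p).right_inv hy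
  rw [← hy'] at hXy hYy ⊢
  exact lieBracket_chartField_eq_zero hq (hXy.of_le (by norm_num)) (hYy.of_le (by norm_num))
    (hXY _)

end Bracket

section FlowAlgebra

variable {E : Type*} [NormedAddCommGroup E] [NormedSpace ℝ E]
  {H : Type*} [TopologicalSpace H] {I : ModelWithCorners ℝ E H} [I.Boundaryless]
  {M : Type*} [TopologicalSpace M] [ChartedSpace H M] [IsManifold I 1 M] [T2Space M]

lemma IsFlow.eq_of_isMIntegralCurve {X : (x : M) → TangentSpace I x} {φ : ℝ → M → M}
    (hφ : IsFlow I X φ)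
    (hX : ContMDiff I I.tangent 1 (fun x => (⟨x, X x⟩ : TangentBundle I M)))
    {γ : ℝ → M} (hγ : IsMIntegralCurve (I := I) γ X) (t : ℝ) : γ t = φ t (γ 0) :=
  congrFun (isMIntegralCurve_Ioo_eq_of_contMDiff_boundaryless (t₀ := 0) hX
    hγ (hφ.isMIntegralCurve _) (hφ.map_zero _).symm) t

lemma IsFlow.map_add {X : (x : M) → TangentSpace I x} {φ : ℝ → M → M}
    (hφ : IsFlow I X φ)
    (hX : ContMDiff I I.tangent 1 (fun x => (⟨x, X x⟩ : TangentBundle I M)))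
    (s t : ℝ) (g : M) : φ (s + t) g = φ s (φ t g) := by
  have := hφ.eq_of_isMIntegralCurve hX ((hφ.isMIntegralCurve g).comp_add t) s
  simpa using this

lemma IsFlow.unique {X : (x : M) → TangentSpace I x} {φ ψ : ℝ → M → M}
    (hφ : IsFlow I X φ) (hψ : IsFlow I X ψ)
    (hX : ContMDiff I I.tangent 1 (fun x => (⟨x, X x⟩ : TangentBundle I M))) : φ = ψ := by
  ext t g
  rw [hψ.eq_of_isMIntegralCurve hX (hφ.isMIntegralCurve g) t, hφ.map_zero]

omit [I.Boundaryless] [IsManifold I 1 M] [T2Space M] in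
lemma IsFlow.smul {X : (x : M) → TangentSpace I x} {φ : ℝ → M → M}
    (hφ : IsFlow I X φ) (a : ℝ) : IsFlow I (a • X) (fun t => φ (t * a)) where
  map_zero g := by rw [zero_mul, hφ.map_zero]
  isMIntegralCurve g := (hφ.isMIntegralCurve g).comp_mul a

lemma addSubgroup_eq_top_of_Ico_subset {S : AddSubgroup ℝ} {ε : ℝ} (hε : 0 < ε)
    (h : ∀ t ∈ Ico 0 ε, t ∈ S) (t : ℝ) : t ∈ S := by
  wlog ht : 0 ≤ t generalizing t
  · exact neg_mem_iff.1 (this (-t) (by linarith))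
  obtain ⟨n, hn⟩ := exists_nat_gt (t / ε)
  have hn0 : (0 : ℝ) < n := (div_nonneg ht hε.le).trans_lt hn
  have h1 : t / n ∈ S := by
    refine h _ ⟨by positivity, ?_⟩
    rw [div_lt_iff₀ hn0]
    rw [div_lt_iff₀ hε] at hn
    linarith
  have h2 := S.nsmul_mem h1 n
  rwa [nsmul_eq_mul, mul_div_cancel₀ _ hn0.ne'] at h2

/-- A map that commutes with a flow for short nonnegative times commutes with it for all times. -/
lemma IsFlow.commute_of_Ico {X : (x : M) → TangentSpace I x} {φ : ℝ → M → M}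
    (hφ : IsFlow I X φ)
    (hX : ContMDiff I I.tangent 1 (fun x => (⟨x, X x⟩ : TangentBundle I M)))
    {f : M → M} {ε : ℝ} (hε : 0 < ε) (h : ∀ t ∈ Ico 0 ε, ∀ g, φ t (f g) = f (φ t g))
    (t : ℝ) (g : M) :
    φ t (f g) = f (φ t g) := by
  let S : AddSubgroup ℝ :=
    { carrier := {t | ∀ g, φ t (f g) = f (φ t g)}
      zero_mem' := fun g => by simp only [hφ.map_zero]
      add_mem' := fun {s t} hs ht g => by rw [hφ.map_add hX, ht, hs, hφ.map_add hX]
      neg_mem' := fun {t} ht g => by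
        have h1 : φ (-t) (φ t (f (φ (-t) g))) = f (φ (-t) g) := by
          rw [← hφ.map_add hX, neg_add_cancel, hφ.map_zero]
        rw [ht, ← hφ.map_add hX, add_neg_cancel, hφ.map_zero] at h1
        exact h1 }
  exact addSubgroup_eq_top_of_Ico_subset (S := S) hε h t g

omit [I.Boundaryless] [IsManifold I 1 M] [T2Space M] in
lemma eq_zero_of_isMIntegralCurve_const {X : (x : M) → TangentSpace I x} {p : M}
    (h : IsMIntegralCurve (I := I) (fun _ => p) X) : X p = 0 := by
  obtain ⟨v, hv⟩ : ∃ v : E, v = X p := ⟨X p, rfl⟩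
  have h0 : HasMFDerivAt 𝓘(ℝ, ℝ) I (fun _ : ℝ => p) 0 ((1 : ℝ →L[ℝ] ℝ).smulRight v) := by
    rw [hv]
    exact h 0
  have h1 : (1 : ℝ →L[ℝ] ℝ).smulRight v = 0 :=
    hasMFDerivAt_unique h0 (hasMFDerivAt_const p (0 : ℝ))
  have h2 := DFunLike.congr_fun h1 (1 : ℝ)
  have h3 : v = 0 := by simpa using h2
  exact hv.symm.trans h3

omit [I.Boundaryless] [IsManifold I 1 M] [T2Space M] in
lemma hasMFDerivAt_of_extChartAt {f : M → M} {p : M} {A : E →L[ℝ] E} (hf : ContinuousAt f p)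
    (hp : f p = p)
    (h : HasFDerivAt (fun x => extChartAt I p (f ((extChartAt I p).symm x))) A
      (extChartAt I p p)) : HasMFDerivAt I I f p A := by
  refine ⟨hf, ?_⟩
  have : writtenInExtChartAt I I p f =
      fun x => extChartAt I p (f ((extChartAt I p).symm x)) := by
    ext x
    simp [writtenInExtChartAt, hp]
  rw [this]
  exact h.hasFDerivWithinAt

end FlowAlgebra

section LieGroup

variable {E : Type*} [NormedAddCommGroup E] [NormedSpace ℝ E]
  {H : Type*} [TopologicalSpace H] {I : ModelWithCorners ℝ E H} [I.Boundaryless]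
  {G : Type*} [TopologicalSpace G] [ChartedSpace H G] [Group G] [LieGroup I ∞ G] [T2Space G]

lemma IsLinearVectorField.exists_mulEquiv {X : (g : G) → TangentSpace I g} {φ : ℝ → G → G}
    (hX : IsLinearVectorField I X) (hφ : IsFlow I X φ) :
    ∃ ψ : ℝ → G ≃* G, (∀ t g, φ t g = ψ t g) ∧ ∀ t, ContMDiff I I ∞ (ψ t) := by
  obtain ⟨ψ, hψ, hs⟩ := hX.exists_flow
  refine ⟨ψ, fun t g => ?_, hs⟩
  rw [hφ.unique hψ (hX.contMDiff.of_le (by norm_cast))]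

lemma IsLinearVectorField.flow_mul {X : (g : G) → TangentSpace I g} {φ : ℝ → G → G}
    (hX : IsLinearVectorField I X) (hφ : IsFlow I X φ) (t : ℝ) (g h : G) :
    φ t (g * h) = φ t g * φ t h := by
  obtain ⟨ψ, hψ, -⟩ := hX.exists_mulEquiv hφ
  simp only [hψ, map_mul]

omit [I.Boundaryless] [T2Space G] in
lemma IsLinearVectorField.apply_one {X : (g : G) → TangentSpace I g}
    (hX : IsLinearVectorField I X) : X 1 = 0 := by
  obtain ⟨ψ, hψ, -⟩ := hX.exists_flow
  have h : IsMIntegralCurve (I := I) (fun _ => (1 : G)) X := by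
    have h1 := hψ.isMIntegralCurve 1
    have h2 : (fun t => (ψ t) 1) = fun _ => (1 : G) := by
      ext t
      exact _root_.map_one _
    rwa [h2] at h1
  exact eq_zero_of_isMIntegralCurve_const h

/-- Linear vector fields with vanishing Lie bracket have commuting flows. -/
lemma IsLinearVectorField.flow_comm [CompleteSpace E] [ConnectedSpace G]
    {X Y : (g : G) → TangentSpace I g}
    {φ ψ : ℝ → G → G} (hX : IsLinearVectorField I X) (hY : IsLinearVectorField I Y)
    (hφ : IsFlow I X φ) (hψ : IsFlow I Y ψ)
    (hXY : ∀ g, VectorField.mlieBracket I X Y g = 0) (s t : ℝ) (g : G) :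
    φ s (ψ t g) = ψ t (φ s g) := by
  have hX1 := hX.contMDiff.of_le (show (1 : WithTop ℕ∞) ≤ ∞ by norm_cast)
  have hY1 := hY.contMDiff.of_le (show (1 : WithTop ℕ∞) ≤ ∞ by norm_cast)
  obtain ⟨ε, hε, hε'⟩ := hφ.hasFDerivAt_exp hX1 hX.apply_one
  obtain ⟨δ, hδ, hδ'⟩ := hψ.hasFDerivAt_exp hY1 hY.apply_one
  have hcomm := commute_fderiv_chartField (hX.contMDiff.of_le (by norm_cast))
    (hY.contMDiff.of_le (by norm_cast)) hX.apply_one hY.apply_one hXY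
  obtain ⟨α, hα, hαs⟩ := hX.exists_mulEquiv hφ
  obtain ⟨β, hβ, hβs⟩ := hY.exists_mulEquiv hψ
  simp only [hα, hβ] at hε' hδ'
  have key : ∀ s ∈ Ico 0 ε, ∀ t ∈ Ico 0 δ, ∀ g, φ s (ψ t g) = ψ t (φ s g) := by
    intro s hs t ht g
    have ha := hasMFDerivAt_of_extChartAt (hαs s).continuous.continuousAt (_root_.map_one _)
      (hε' s hs)
    have hb := hasMFDerivAt_of_extChartAt (hβs t).continuous.continuousAt (_root_.map_one _)
      (hδ' t ht)
    have hab := hasMFDerivAt_comp_of_eq (_root_.map_one (β t)) ha hb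
    have hba := hasMFDerivAt_comp_of_eq (_root_.map_one (α s)) hb ha
    have hE : Commute
        (NormedSpace.exp (s • fderiv ℝ (chartField (1 : G) X) (extChartAt I (1 : G) 1)))
        (NormedSpace.exp (t • fderiv ℝ (chartField (1 : G) Y) (extChartAt I (1 : G) 1))) :=
      ((hcomm.smul_left s).smul_right t).exp
    have h := monoidHom_eq_of_hasMFDerivAt_one (α := (α s).toMonoidHom.comp (β t).toMonoidHom)
      (β := (β t).toMonoidHom.comp (α s).toMonoidHom)
      (((hβs t).comp (hαs s)).mdifferentiable (by norm_num)) hab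
      (hasMFDerivAt_congr_deriv hE.eq.symm hba)
    rw [hα, hβ, hα, hβ]
    exact DFunLike.congr_fun h g
  refine hφ.commute_of_Ico hX1 hε (fun s hs g => ?_) s g
  exact (hψ.commute_of_Ico hY1 (f := φ s) hδ (fun t ht g => (key s hs t ht g).symm) t g).symm

end LieGroup

section FlowSum

variable {E : Type*} [NormedAddCommGroup E] [NormedSpace ℝ E]
  {H : Type*} [TopologicalSpace H] {I : ModelWithCorners ℝ E H} [I.Boundaryless]
  {M : Type*} [TopologicalSpace M] [ChartedSpace H M] [IsManifold I 1 M] [T2Space M]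

/-- The composition of two commuting flows is the flow of the sum of the vector fields. -/
lemma IsFlow.add [CompleteSpace E] {X Y : (x : M) → TangentSpace I x} {φ ψ : ℝ → M → M}
    (hφ : IsFlow I X φ) (hψ : IsFlow I Y ψ)
    (hX : ContMDiff I I.tangent 1 (fun x => (⟨x, X x⟩ : TangentBundle I M)))
    (hY : ContMDiff I I.tangent 1 (fun x => (⟨x, Y x⟩ : TangentBundle I M)))
    (hcomm : ∀ s t g, φ s (ψ t g) = ψ t (φ s g)) :
    IsFlow I (X + Y) (fun t g => φ t (ψ t g)) where
  map_zero g := by rw [hψ.map_zero, hφ.map_zero]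
  isMIntegralCurve g t₀ := by
    set γ : ℝ → M := fun t => φ t (ψ t g)
    have hγ : ∀ s, γ s = φ (s - t₀) (ψ (s - t₀) (γ t₀)) := by
      intro s
      simp only [γ]
      rw [hcomm t₀ t₀ g, ← hψ.map_add hY, sub_add_cancel, hcomm (s - t₀), ← hφ.map_add hX,
        sub_add_cancel, hcomm]
    have hc := (hψ.isMIntegralCurve (γ t₀)).continuous.continuousAt (x := 0)
    have hsrc : ψ 0 (γ t₀) ∈ (chartAt H (γ t₀)).source := by
      rw [hψ.map_zero]
      exact mem_chart_source H _
    have h1 := hasDerivAt_extChartAt_comp (hψ.isMIntegralCurve (γ t₀) 0) hsrc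
    rw [← chartField_extChartAt (γ t₀) Y hsrc] at h1
    obtain ⟨h2, h3⟩ := hφ.hasDerivAt_chart_comp hX (hψ.map_zero _) hc h1
    rw [hψ.map_zero, chartField_self, chartField_self] at h3
    have h4 : HasDerivAt (extChartAt I (γ t₀) ∘ γ) ((Y (γ t₀) : E) + (X (γ t₀) : E)) t₀ := by
      have h5 := HasDerivAt.comp_sub_const t₀ t₀ (by rwa [sub_self])
        (f := fun t => extChartAt I (γ t₀) (φ t (ψ t (γ t₀))))
      refine HasDerivAt.congr_of_eventuallyEq h5 (Eventually.of_forall fun s => ?_)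
      exact congrArg (extChartAt I (γ t₀)) (hγ s)
    have hev : ∀ᶠ s in 𝓝 t₀, γ s ∈ (extChartAt I (γ t₀)).source := by
      have ht : Tendsto (fun s => s - t₀) (𝓝 t₀) (𝓝 0) := by
        have : Tendsto (fun s => s - t₀) (𝓝 t₀) (𝓝 (t₀ - t₀)) :=
          (continuous_id.sub continuous_const).tendsto t₀
        rwa [sub_self] at this
      filter_upwards [ht.eventually h2] with s hs
      rw [hγ s, extChartAt_source]
      exact hs
    have hcont : ContinuousAt γ t₀ := by
      have h6 : ContinuousAt ((extChartAt I (γ t₀)).symm ∘ (extChartAt I (γ t₀) ∘ γ)) t₀ :=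
        ContinuousAt.comp (continuousAt_extChartAt_symm (γ t₀)) h4.continuousAt
      refine h6.congr ?_
      filter_upwards [hev] with s hs
      exact (extChartAt I (γ t₀)).left_inv hs
    refine hasMFDerivAt_of_extChartAt_comp hcont (mem_chart_source H (γ t₀)) ?_
    have h7 : tangentCoordChange I (γ t₀) (γ t₀) (γ t₀) ((X + Y) (γ t₀)) =
        (Y (γ t₀) : E) + (X (γ t₀) : E) :=
      (tangentCoordChange_self (mem_extChartAt_source _)).trans (add_comm (X (γ t₀)) (Y (γ t₀)))
    exact h7.symm ▸ h4

omit [I.Boundaryless] [T2Space M] in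
lemma contMDiff_sum_smul {n : WithTop ℕ∞} {ι : Type*} [Fintype ι]
    {X : ι → (x : M) → TangentSpace I x} (w : ι → ℝ)
    (hX : ∀ i, ContMDiff I I.tangent n (fun x => (⟨x, X i x⟩ : TangentBundle I M))) :
    ContMDiff I I.tangent n (fun x => (⟨x, (∑ i, w i • X i) x⟩ : TangentBundle I M)) := by
  have h : ContMDiff I I.tangent n (fun x => (⟨x, ∑ i, (w i • X i) x⟩ : TangentBundle I M)) :=
    ContMDiff.sum_section fun i _ => ContMDiff.const_smul_section (hX i)
  have e : (∑ i, w i • X i) = fun x => ∑ i, (w i • X i) x := by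
    ext x
    exact Finset.sum_apply x _ _
  rw [e]
  exact h

omit [I.Boundaryless] [T2Space M] in
lemma contMDiff_const_smul {n : WithTop ℕ∞} {X : (x : M) → TangentSpace I x} (a : ℝ)
    (hX : ContMDiff I I.tangent n (fun x => (⟨x, X x⟩ : TangentBundle I M))) :
    ContMDiff I I.tangent n (fun x => (⟨x, (a • X) x⟩ : TangentBundle I M)) :=
  ContMDiff.const_smul_section (a := a) hX

omit [I.Boundaryless] [IsManifold I 1 M] [T2Space M] in
lemma IsFlow.zero : IsFlow I (0 : (x : M) → TangentSpace I x) (fun _ => id) where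
  map_zero _ := rfl
  isMIntegralCurve _ := isMIntegralCurve_const rfl

/-- The composition of finitely many commuting flows, run at constant speeds, is a flow. -/
lemma IsFlow.sum [CompleteSpace E] {n : ℕ} {X : Fin n → (x : M) → TangentSpace I x}
    {φ : Fin n → ℝ → M → M} (hφ : ∀ i, IsFlow I (X i) (φ i))
    (hX : ∀ i, ContMDiff I I.tangent 1 (fun x => (⟨x, X i x⟩ : TangentBundle I M)))
    (hcomm : ∀ i j s t g, φ i s (φ j t g) = φ j t (φ i s g)) (w : Fin n → ℝ) :
    IsFlow I (∑ i, w i • X i)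
      (fun t => (List.ofFn fun i => φ i (t * w i)).foldr (fun f h => f ∘ h) id) := by
  induction n with
  | zero => simpa using IsFlow.zero
  | succ n ih =>
    have h1 := ih (fun i => hφ i.succ) (fun i => hX i.succ)
      (fun i j => hcomm i.succ j.succ) (fun i => w i.succ)
    have h2 := (hφ 0).smul (w 0)
    rw [Fin.sum_univ_succ]
    simp only [List.ofFn_succ, List.foldr_cons]
    refine h2.add h1 (contMDiff_const_smul _ (hX 0)) (contMDiff_sum_smul _ fun i => hX i.succ) ?_
    · intro s t g
      have : ∀ (l : List (M → M)), (∀ f ∈ l, ∀ x, φ 0 (s * w 0) (f x) = f (φ 0 (s * w 0) x)) →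
          ∀ x, φ 0 (s * w 0) (l.foldr (fun f h => f ∘ h) id x) =
            l.foldr (fun f h => f ∘ h) id (φ 0 (s * w 0) x) := by
        intro l
        induction l with
        | nil => intro _ x; rfl
        | cons f l ihl =>
          intro hl x
          simp only [List.foldr_cons, Function.comp_apply]
          rw [hl f (by simp), ihl (fun f hf => hl f (by simp [hf]))]
      refine this _ ?_ g
      intro f hf x
      obtain ⟨i, rfl⟩ := (List.mem_ofFn' _ _).1 hf
      exact hcomm _ _ _ _ _

end FlowSum

section Product

variable {E : Type*} [NormedAddCommGroup E] [NormedSpace ℝ E]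
  {H : Type*} [TopologicalSpace H] {I : ModelWithCorners ℝ E H}
  {G : Type*} [TopologicalSpace G] [ChartedSpace H G] [Group G] [LieGroup I ∞ G]

omit [Group G] [LieGroup I ∞ G] in
lemma field_congr (X : (g : G) → TangentSpace I g) {p q : G} (h : p = q) :
    (X p : E) = (X q : E) := by
  subst h
  rfl

lemma mdifferentiable_mul_const (h : G) : MDifferentiable I I (fun x : G => x * h) :=
  (contMDiff_mul_right (I := I) (n := ∞) (a := h)).mdifferentiable (by norm_num)

lemma mdifferentiable_const_mul (h : G) : MDifferentiable I I (fun x : G => h * x) :=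
  (contMDiff_mul_left (I := I) (n := ∞) (a := h)).mdifferentiable (by norm_num)

/-- The product rule for the multiplication of a Lie group. -/
lemma hasMFDerivAt_mul {g h : G} {A B : E →L[ℝ] E}
    (hA : HasMFDerivAt I I (fun x : G => x * h) g A)
    (hB : HasMFDerivAt I I (fun x : G => g * x) h B) :
    HasMFDerivAt (I.prod I) I (fun q : G × G => q.1 * q.2) (g, h)
      (A.coprod B : E × E →L[ℝ] E) := by
  have hmul : MDifferentiable (I.prod I) I (fun q : G × G => q.1 * q.2) :=
    (contMDiff_mul I ∞).mdifferentiable (by norm_num)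
  obtain ⟨m, hm⟩ := exists_hasMFDerivAt (E := E × E) (hmul (g, h))
  have h1 := hasMFDerivAt_comp_of_eq (f := fun x : G => (x, h)) (x := g) rfl hm
    ((hasMFDerivAt_id (I := I) g).prodMk (hasMFDerivAt_const (I := I) h g))
  have h2 := hasMFDerivAt_comp_of_eq (f := fun x : G => (g, x)) (x := h) rfl hm
    ((hasMFDerivAt_const (I := I) g h).prodMk (hasMFDerivAt_id (I := I) h))
  have h3 : A = m.comp ((ContinuousLinearMap.id ℝ E).prod (0 : E →L[ℝ] E)) :=
    hasMFDerivAt_unique hA h1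
  have h4 : B = m.comp ((0 : E →L[ℝ] E).prod (ContinuousLinearMap.id ℝ E)) :=
    hasMFDerivAt_unique hB h2
  refine hasMFDerivAt_congr_deriv ?_ hm
  ext v
  · simp [h3]
  · simp [h4]

lemma hasMFDerivAt_curve_mul {a b : ℝ → G} {t : ℝ} {v w : E} {A B : E →L[ℝ] E}
    (ha : HasMFDerivAt 𝓘(ℝ, ℝ) I a t ((1 : ℝ →L[ℝ] ℝ).smulRight v))
    (hb : HasMFDerivAt 𝓘(ℝ, ℝ) I b t ((1 : ℝ →L[ℝ] ℝ).smulRight w))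
    (hA : HasMFDerivAt I I (fun x : G => x * b t) (a t) A)
    (hB : HasMFDerivAt I I (fun x : G => a t * x) (b t) B) :
    HasMFDerivAt 𝓘(ℝ, ℝ) I (fun s => a s * b s) t
      ((1 : ℝ →L[ℝ] ℝ).smulRight (A v + B w)) := by
  have h1 := hasMFDerivAt_comp_of_eq (f := fun s => (a s, b s)) rfl (hasMFDerivAt_mul hA hB)
    (ha.prodMk hb)
  refine hasMFDerivAt_congr_deriv ?_ h1
  have : (A.coprod B).comp (((1 : ℝ →L[ℝ] ℝ).smulRight v).prod ((1 : ℝ →L[ℝ] ℝ).smulRight w)) =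
      (1 : ℝ →L[ℝ] ℝ).smulRight (A v + B w) := by
    ext
    simp
  exact this

omit [Group G] [LieGroup I ∞ G] in
lemma IsFlow.hasMFDerivAt_zero {X : (g : G) → TangentSpace I g} {φ : ℝ → G → G}
    (hφ : IsFlow I X φ) (g : G) :
    HasMFDerivAt 𝓘(ℝ, ℝ) I (fun t => φ t g) 0 ((1 : ℝ →L[ℝ] ℝ).smulRight (X g : E)) := by
  obtain ⟨w, hw⟩ : ∃ w : E, w = X g := ⟨X g, rfl⟩
  have h1 : w = X (φ 0 g) := hw.trans (field_congr X (hφ.map_zero g)).symm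
  have h2 : HasMFDerivAt 𝓘(ℝ, ℝ) I (fun t => φ t g) 0 ((1 : ℝ →L[ℝ] ℝ).smulRight w) := by
    rw [h1]
    exact hφ.isMIntegralCurve g 0
  exact hw ▸ h2

/-- A vector field is infinitesimally multiplicative if it is a derivation with respect to the
multiplication of the Lie group. -/
def IsMultiplicativeField (I : ModelWithCorners ℝ E H) [LieGroup I ∞ G]
    (X : (g : G) → TangentSpace I g) : Prop :=
  ∀ (g h : G) (A B : E →L[ℝ] E), HasMFDerivAt I I (fun x : G => x * h) g A →
    HasMFDerivAt I I (fun x : G => g * x) h B → (X (g * h) : E) = A (X g) + B (X h)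

lemma IsFlow.isMultiplicativeField {X : (g : G) → TangentSpace I g} {φ : ℝ → G → G}
    (hφ : IsFlow I X φ) (hmul : ∀ t g h, φ t (g * h) = φ t g * φ t h) :
    IsMultiplicativeField I X := by
  intro g h A B hA hB
  obtain ⟨u, hu⟩ : ∃ u : E, u = X (g * h) := ⟨X (g * h), rfl⟩
  obtain ⟨v, hv⟩ : ∃ v : E, v = X g := ⟨X g, rfl⟩
  obtain ⟨w, hw⟩ : ∃ w : E, w = X h := ⟨X h, rfl⟩
  have h1 : HasMFDerivAt 𝓘(ℝ, ℝ) I (fun t => φ t (g * h)) 0 ((1 : ℝ →L[ℝ] ℝ).smulRight u) :=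
    hu ▸ hφ.hasMFDerivAt_zero (g * h)
  have h2 : HasMFDerivAt 𝓘(ℝ, ℝ) I (fun t => φ t g) 0 ((1 : ℝ →L[ℝ] ℝ).smulRight v) :=
    hv ▸ hφ.hasMFDerivAt_zero g
  have h3 : HasMFDerivAt 𝓘(ℝ, ℝ) I (fun t => φ t h) 0 ((1 : ℝ →L[ℝ] ℝ).smulRight w) :=
    hw ▸ hφ.hasMFDerivAt_zero h
  have h4 := hasMFDerivAt_curve_mul h2 h3 (by rw [hφ.map_zero, hφ.map_zero]; exact hA)
    (by rw [hφ.map_zero, hφ.map_zero]; exact hB)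
  have e : (fun t => φ t (g * h)) = fun t => φ t g * φ t h := funext fun t => hmul t g h
  have h1' : HasMFDerivAt 𝓘(ℝ, ℝ) I (fun t => φ t g * φ t h) 0
      ((1 : ℝ →L[ℝ] ℝ).smulRight u) := e ▸ h1
  have h5 : (1 : ℝ →L[ℝ] ℝ).smulRight u = (1 : ℝ →L[ℝ] ℝ).smulRight (A v + B w) :=
    hasMFDerivAt_unique h1' h4
  have h6 := DFunLike.congr_fun h5 1
  have h7 : u = A v + B w := by simpa using h6
  exact hu.symm.trans (h7.trans (congrArg₂ (fun x y : E => A x + B y) hv hw))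

end Product

section RightInvariant

variable {E : Type*} [NormedAddCommGroup E] [NormedSpace ℝ E]
  {H : Type*} [TopologicalSpace H] {I : ModelWithCorners ℝ E H}
  {G : Type*} [TopologicalSpace G] [ChartedSpace H G] [Group G] [LieGroup I ∞ G]

omit [LieGroup I ∞ G] in
lemma IsRightInvariant.hasMFDerivAt_apply {Y : (g : G) → TangentSpace I g}
    (hY : IsRightInvariant I Y) {g h : G} {A : E →L[ℝ] E}
    (hA : HasMFDerivAt I I (fun x : G => x * h) g A) : A (Y g) = (Y (g * h) : E) := by
  have h1 : A = mfderiv I I (fun x : G => x * h) g := hA.mfderiv.symm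
  rw [h1]
  exact hY g h

omit [Group G] [LieGroup I ∞ G] in
lemma tangentBundle_mk_congr {p q : G} {v w : E} (h : p = q) (hvw : v = w) :
    (⟨p, v⟩ : TangentBundle I G) = ⟨q, w⟩ := by
  subst h
  subst hvw
  rfl

lemma IsRightInvariant.contMDiff {Y : (g : G) → TangentSpace I g} (hY : IsRightInvariant I Y) :
    ContMDiff I I.tangent 1 (fun g => (⟨g, Y g⟩ : TangentBundle I G)) := by
  let F₁ : G → TangentBundle I G × TangentBundle I G := fun g => (⟨1, Y 1⟩, ⟨g, 0⟩)
  have S₁ : ContMDiff I (I.tangent.prod I.tangent) 1 F₁ :=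
    ContMDiff.prodMk contMDiff_const
      (Bundle.contMDiff_zeroSection ℝ (TangentSpace I : G → Type _))
  have S₂ : ContMDiff (I.tangent.prod I.tangent) (I.prod I).tangent 1
      (equivTangentBundleProd I G I G).symm := contMDiff_equivTangentBundleProd_symm
  have S₃ : ContMDiff (I.prod I).tangent I.tangent 1
      (tangentMap (I.prod I) I (fun p : G × G => p.1 * p.2)) :=
    ContMDiff.contMDiff_tangentMap (contMDiff_mul I 2) (by norm_num)
  have S := (S₃.comp S₂).comp S₁
  refine S.congr fun g => ?_
  obtain ⟨A, hA⟩ := exists_hasMFDerivAt (mdifferentiable_mul_const (I := I) g 1)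
  obtain ⟨B, hB⟩ := exists_hasMFDerivAt (mdifferentiable_const_mul (I := I) 1 g)
  have hm := hasMFDerivAt_mul hA hB
  refine tangentBundle_mk_congr (one_mul g).symm ?_
  have h1 : (mfderiv (I.prod I) I (fun p : G × G => p.1 * p.2) (1, g)) = A.coprod B := hm.mfderiv
  have h2 : (Y g : E) = (A.coprod B) ((Y 1 : E), (0 : E)) := by
    have h3 : (A.coprod B) ((Y 1 : E), (0 : E)) = A (Y 1) := by
      rw [ContinuousLinearMap.coprod_apply]
      erw [_root_.map_zero]
      exact add_zero _
    rw [h3, hY.hasMFDerivAt_apply hA]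
    exact (field_congr Y (one_mul g)).symm
  rw [h2]
  exact (DFunLike.congr_fun h1 _).symm

end RightInvariant

section AffineFlow

variable {E : Type*} [NormedAddCommGroup E] [NormedSpace ℝ E]
  {H : Type*} [TopologicalSpace H] {I : ModelWithCorners ℝ E H}
  {G : Type*} [TopologicalSpace G] [ChartedSpace H G] [Group G] [LieGroup I ∞ G]

/-- If `X` is multiplicative and `Y` right invariant, then the product of an integral curve of
`X + Y` and an integral curve of `X` is an integral curve of `X + Y`. -/
lemma IsMIntegralCurveOn.mul_of_isMultiplicativeField {X Y : (g : G) → TangentSpace I g}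
    (hX : IsMultiplicativeField I X) (hY : IsRightInvariant I Y) {a b : ℝ → G} {s : Set ℝ}
    (hs : IsOpen s)
    (ha : IsMIntegralCurveOn (I := I) a (X + Y) s) (hb : IsMIntegralCurveOn (I := I) b X s) :
    IsMIntegralCurveOn (I := I) (fun t => a t * b t) (X + Y) s := by
  intro t ht
  have ha' := (ha t ht).hasMFDerivAt (hs.mem_nhds ht)
  have hb' := (hb t ht).hasMFDerivAt (hs.mem_nhds ht)
  obtain ⟨v, hv⟩ : ∃ v : E, v = (X + Y) (a t) := ⟨(X + Y) (a t), rfl⟩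
  obtain ⟨w, hw⟩ : ∃ w : E, w = X (b t) := ⟨X (b t), rfl⟩
  obtain ⟨u, hu⟩ : ∃ u : E, u = (X + Y) (a t * b t) := ⟨(X + Y) (a t * b t), rfl⟩
  obtain ⟨A, hA⟩ := exists_hasMFDerivAt (mdifferentiable_mul_const (I := I) (b t) (a t))
  obtain ⟨B, hB⟩ := exists_hasMFDerivAt (mdifferentiable_const_mul (I := I) (a t) (b t))
  have h1 : HasMFDerivAt 𝓘(ℝ, ℝ) I a t ((1 : ℝ →L[ℝ] ℝ).smulRight v) := hv ▸ ha'
  have h2 : HasMFDerivAt 𝓘(ℝ, ℝ) I b t ((1 : ℝ →L[ℝ] ℝ).smulRight w) := hw ▸ hb'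
  have h3 := hasMFDerivAt_curve_mul h1 h2 hA hB
  have h4 : A v + B w = u := by
    have h5 : u = (A (X (a t)) + B (X (b t))) + A (Y (a t)) :=
      hu.trans (congrArg₂ (fun x y : E => x + y) (hX _ _ A B hA hB)
        (hY.hasMFDerivAt_apply hA).symm)
    have h6 : A v = A (X (a t)) + A (Y (a t)) :=
      (congrArg A hv).trans (_root_.map_add A (X (a t) : E) (Y (a t) : E))
    have h7 : B w = B (X (b t)) := congrArg B hw
    rw [h5, h6, h7]
    exact add_right_comm (A (X (a t))) (A (Y (a t))) (B (X (b t)))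
  have h8 : HasMFDerivAt 𝓘(ℝ, ℝ) I (fun t => a t * b t) t ((1 : ℝ →L[ℝ] ℝ).smulRight u) :=
    hasMFDerivAt_congr_deriv (by rw [h4]) h3
  have h9 : HasMFDerivAt 𝓘(ℝ, ℝ) I (fun t => a t * b t) t
      ((1 : ℝ →L[ℝ] ℝ).smulRight ((X + Y) (a t * b t))) := hu ▸ h8
  exact h9.hasMFDerivWithinAt

lemma isMultiplicativeField_sum_smul {ι : Type*} [Fintype ι]
    {X : ι → (g : G) → TangentSpace I g} (w : ι → ℝ)
    (hX : ∀ i, IsMultiplicativeField I (X i)) : IsMultiplicativeField I (∑ i, w i • X i) := by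
  have e : ∀ g, ((∑ i, w i • X i) g : E) = ∑ i, w i • (X i g : E) := fun g =>
    Finset.sum_apply g Finset.univ (fun i => w i • X i)
  intro g h A B hA hB
  have h1 : ∀ i, (X i (g * h) : E) = A (X i g) + B (X i h) := fun i => hX i g h A B hA hB
  refine (e (g * h)).trans ?_
  refine Eq.trans ?_ (congrArg₂ (fun x y : E => A x + B y) (e g) (e h)).symm
  have h2 : ∀ x y z : ι → E, (∀ i, x i = A (y i) + B (z i)) →
      ∑ i, w i • x i = A (∑ i, w i • y i) + B (∑ i, w i • z i) := by
    intro x y z hxyz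
    simp only [hxyz, smul_add, Finset.sum_add_distrib, map_sum, map_smul]
  exact h2 _ _ _ h1

omit [LieGroup I ∞ G] in
lemma isRightInvariant_sum_smul {ι : Type*} [Fintype ι]
    {Y : ι → (g : G) → TangentSpace I g} (w : ι → ℝ)
    (hY : ∀ i, IsRightInvariant I (Y i)) : IsRightInvariant I (∑ i, w i • Y i) := by
  have e : ∀ g, ((∑ i, w i • Y i) g : E) = ∑ i, w i • (Y i g : E) := fun g =>
    Finset.sum_apply g Finset.univ (fun i => w i • Y i)
  intro g h
  obtain ⟨A, hA⟩ : ∃ A : E →L[ℝ] E, A = mfderiv I I (fun x : G => x * h) g := ⟨_, rfl⟩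
  have h1 : ∀ i, A (Y i g) = (Y i (g * h) : E) := fun i => by rw [hA]; exact hY i g h
  rw [← hA]
  refine Eq.trans (congrArg A (e g)) (Eq.trans ?_ (e (g * h)).symm)
  have h2 : ∀ x y : ι → E, (∀ i, A (x i) = y i) → A (∑ i, w i • x i) = ∑ i, w i • y i := by
    intro x y hxy
    simp only [← hxy, map_sum, map_smul]
  exact h2 _ _ h1

variable [I.Boundaryless] [T2Space G] [CompleteSpace E]

/-- The sum of a complete multiplicative vector field and of a right invariant vector field is
complete. -/
lemma IsFlow.exists_add_isRightInvariant {X Y : (g : G) → TangentSpace I g} {ψ : ℝ → G → G}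
    (hψ : IsFlow I X ψ)
    (hX : ContMDiff I I.tangent 1 (fun g => (⟨g, X g⟩ : TangentBundle I G)))
    (hXm : IsMultiplicativeField I X) (hY : IsRightInvariant I Y) :
    ∃ Φ : ℝ → G → G, IsFlow I (X + Y) Φ ∧ ∀ t g, Φ t g = Φ t 1 * ψ t g := by
  have hZ : ContMDiff I I.tangent 1 (fun g => (⟨g, (X + Y) g⟩ : TangentBundle I G)) :=
    ContMDiff.add_section hX hY.contMDiff
  have hloc : ∃ ε > 0, ∃ a : ℝ → G, a 0 = 1 ∧
      IsMIntegralCurveOn (I := I) a (X + Y) (Ioo (-ε) ε) := by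
    obtain ⟨a, ha0, ha⟩ := exists_isMIntegralCurveAt_of_contMDiffAt_boundaryless (t₀ := 0)
      (hZ (1 : G))
    rw [isMIntegralCurveAt_iff'] at ha
    obtain ⟨ε, hε, ha⟩ := ha
    rw [Real.ball_eq_Ioo, zero_sub, zero_add] at ha
    exact ⟨ε, hε, a, ha0, ha⟩
  obtain ⟨ε, hε, a, ha0, ha⟩ := hloc
  have hglob := exists_isMIntegralCurve_of_isMIntegralCurveOn hZ hε (fun g =>
    ⟨fun t => a t * ψ t g, by
      change a 0 * ψ 0 g = g
      rw [ha0, hψ.map_zero, one_mul],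
      IsMIntegralCurveOn.mul_of_isMultiplicativeField hXm hY isOpen_Ioo ha
        ((hψ.isMIntegralCurve g).isMIntegralCurveOn _)⟩)
  choose γ hγ0 hγ using hglob
  have hΦ : IsFlow I (X + Y) (fun t g => γ g t) := ⟨hγ0, hγ⟩
  refine ⟨_, hΦ, fun t g => ?_⟩
  have h := IsMIntegralCurveOn.mul_of_isMultiplicativeField hXm hY isOpen_univ
    ((hΦ.isMIntegralCurve 1).isMIntegralCurveOn _) ((hψ.isMIntegralCurve g).isMIntegralCurveOn _)
  rw [← isMIntegralCurve_iff_isMIntegralCurveOn] at h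
  have h2 := hΦ.eq_of_isMIntegralCurve hZ h t
  rw [hγ0, hψ.map_zero, one_mul] at h2
  exact h2.symm

end AffineFlow

section AffineSystem

variable {E : Type*} [NormedAddCommGroup E] [NormedSpace ℝ E]
  {H : Type*} [TopologicalSpace H] {I : ModelWithCorners ℝ E H}
  {G : Type*} [TopologicalSpace G] [ChartedSpace H G]

lemma affineField_eq {m : ℕ} (X Y : Fin (m + 1) → (g : G) → TangentSpace I g) (v : Fin m → ℝ) :
    affineField X Y v =
      (∑ i, (Fin.cons 1 v : Fin (m + 1) → ℝ) i • X i) +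
        ∑ i, (Fin.cons 1 v : Fin (m + 1) → ℝ) i • Y i := by
  rw [Fin.sum_univ_succ, Fin.sum_univ_succ]
  simp only [Fin.cons_zero, Fin.cons_succ, one_smul]
  rw [add_add_add_comm, ← Finset.sum_add_distrib]
  ext g
  refine congrArg (fun x : TangentSpace I g => (X 0 g + Y 0 g) + x) ?_
  refine Eq.trans ?_ (Finset.sum_apply g Finset.univ (fun i => v i • X i.succ + v i • Y i.succ)).symm
  exact Finset.sum_congr rfl fun i _ => smul_add (v i) (X i.succ g) (Y i.succ g)

omit [TopologicalSpace G] in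
lemma rho_timeVec {m : ℕ} (φ : Fin (m + 1) → ℝ → G → G) (v : Fin m → ℝ) (t : ℝ) :
    rho φ (timeVec v t) = (List.ofFn fun i => φ i (t * (Fin.cons 1 v : Fin (m + 1) → ℝ) i)).foldr
      (fun f h => f ∘ h) id := by
  have : timeVec v t = fun i => t * (Fin.cons 1 v : Fin (m + 1) → ℝ) i := by
    ext i
    refine Fin.cases ?_ (fun j => ?_) i
    · simp [timeVec]
    · simp [timeVec, mul_comm]
  rw [this]
  rfl

variable [I.Boundaryless] [Group G] [LieGroup I ∞ G] [T2Space G] [CompleteSpace E]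

omit [I.Boundaryless] [T2Space G] [CompleteSpace E] in
lemma contMDiff_affineField {m : ℕ} {X Y : Fin (m + 1) → (g : G) → TangentSpace I g}
    (hX : ∀ i, IsLinearVectorField I (X i)) (hY : ∀ i, IsRightInvariant I (Y i))
    (v : Fin m → ℝ) :
    ContMDiff I I.tangent 1 (fun g => (⟨g, affineField X Y v g⟩ : TangentBundle I G)) := by
  rw [affineField_eq]
  exact ContMDiff.add_section
    (contMDiff_sum_smul _ fun i => (hX i).contMDiff.of_le (by norm_cast))
    (isRightInvariant_sum_smul _ hY).contMDiff

lemma exists_isFlow_affineField [ConnectedSpace G] {m : ℕ}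
    {X Y : Fin (m + 1) → (g : G) → TangentSpace I g}
    (hX : ∀ i, IsLinearVectorField I (X i)) (hY : ∀ i, IsRightInvariant I (Y i))
    (hcomm : ∀ i j, ∀ g : G, VectorField.mlieBracket I (X i) (X j) g = 0)
    {φ : Fin (m + 1) → ℝ → G → G} (hφ : ∀ i, IsFlow I (X i) (φ i)) (v : Fin m → ℝ) :
    ∃ Φ : ℝ → G → G, IsFlow I (affineField X Y v) Φ ∧
      ∀ t g, Φ t g = Φ t 1 * rho φ (timeVec v t) g := by
  have hX1 : ∀ i, ContMDiff I I.tangent 1 (fun g => (⟨g, X i g⟩ : TangentBundle I G)) :=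
    fun i => (hX i).contMDiff.of_le (by norm_cast)
  obtain ⟨Φ, hΦ, hf⟩ := (IsFlow.sum hφ hX1
      (fun i j => (hX i).flow_comm (hX j) (hφ i) (hφ j) (hcomm i j))
      (Fin.cons 1 v)).exists_add_isRightInvariant
    (contMDiff_sum_smul _ hX1)
    (isMultiplicativeField_sum_smul _ fun i =>
      (hφ i).isMultiplicativeField ((hX i).flow_mul (hφ i)))
    (isRightInvariant_sum_smul (Fin.cons 1 v) hY)
  refine ⟨Φ, ?_, fun t g => ?_⟩
  · rw [affineField_eq]
    exact hΦ
  · rw [rho_timeVec]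
    exact hf t g

end AffineSystem

lemma absolutelyContinuousOnInterval_congr {f g : ℝ → ℝ} {a b : ℝ}
    (hf : AbsolutelyContinuousOnInterval f a b) (hfg : EqOn f g (uIcc a b)) :
    AbsolutelyContinuousOnInterval g a b := by
  rw [absolutelyContinuousOnInterval_iff] at hf ⊢
  intro ε hε
  obtain ⟨δ, hδ, h⟩ := hf ε hε
  refine ⟨δ, hδ, fun E hE hlt => ?_⟩
  refine (Finset.sum_congr rfl fun i hi => ?_).trans_lt (h E hE hlt)
  rw [hfg (hE.1 i hi).1, hfg (hE.1 i hi).2]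

/-- A curve that is weakly absolutely continuous and whose derivative is almost everywhere equal
to a continuous function is differentiable with this derivative. -/
lemma hasDerivAt_of_absolutelyContinuous {E : Type*} [NormedAddCommGroup E] [NormedSpace ℝ E]
    [CompleteSpace E] {x K : ℝ → E} {c d t₀ : ℝ} (ht₀ : t₀ ∈ Ioo c d)
    (hK : ContinuousOn K (Icc c d))
    (hx : ∀ l : E →L[ℝ] ℝ, AbsolutelyContinuousOnInterval (fun t => l (x t)) c d)
    (hd : ∀ᵐ t, t ∈ Ioo c d → HasDerivAt x (K t) t) : HasDerivAt x (K t₀) t₀ := by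
  have hcd : c ≤ d := (ht₀.1.trans ht₀.2).le
  have hint : ∀ t ∈ Icc c d, IntervalIntegrable K volume c t := fun t ht =>
    (hK.mono (by rw [uIcc_of_le ht.1]; exact Icc_subset_Icc_right ht.2)).intervalIntegrable
  have key : ∀ t ∈ Icc c d, x t = x c + ∫ s in c..t, K s := by
    intro t ht
    rw [← sub_eq_iff_eq_add', ← sub_eq_zero]
    refine SeparatingDual.eq_zero_of_forall_dual_eq_zero (R := ℝ) fun l => ?_
    have hac : AbsolutelyContinuousOnInterval (fun t => l (x t)) c t :=
      (hx l).mono (by rw [uIcc_of_le ht.1, uIcc_of_le hcd]; exact Icc_subset_Icc_right ht.2)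
    have h1 := hac.integral_deriv_eq_sub
    have h2 : ∫ s in c..t, deriv (fun t => l (x t)) s = ∫ s in c..t, l (K s) := by
      refine intervalIntegral.integral_congr_ae ?_
      have hne : ∀ᵐ s : ℝ, s ≠ d := by
        rw [ae_iff]
        simp
      filter_upwards [hd, hne] with s hs hsd hst
      rw [uIoc_of_le ht.1] at hst
      exact (l.hasFDerivAt.comp_hasDerivAt s
        (hs ⟨hst.1, lt_of_le_of_ne (hst.2.trans ht.2) hsd⟩)).deriv
    rw [map_sub, map_sub, ← h1, h2, l.intervalIntegral_comp_comm (hint t ht), sub_self]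
  have hnhds : Icc c d ∈ 𝓝 t₀ := Icc_mem_nhds ht₀.1 ht₀.2
  have h1 : HasDerivAt (fun t => x c + ∫ s in c..t, K s) (K t₀) t₀ := by
    refine (intervalIntegral.integral_hasDerivAt_right (hint t₀ (Ioo_subset_Icc_self ht₀)) ?_
      (hK.continuousAt hnhds)).const_add _
    exact hK.stronglyMeasurableAtFilter_nhdsWithin measurableSet_Icc t₀ |>.filter_mono
      (by rw [nhdsWithin_eq_nhds.2 hnhds])
  refine h1.congr_of_eventuallyEq ?_
  filter_upwards [hnhds] with t ht using key t ht

section Caratheodory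

variable {E : Type*} [NormedAddCommGroup E] [NormedSpace ℝ E] [FiniteDimensional ℝ E]
  {H : Type*} [TopologicalSpace H] {I : ModelWithCorners ℝ E H} [I.Boundaryless]
  {M : Type*} [TopologicalSpace M] [ChartedSpace H M] [IsManifold I ∞ M] [T2Space M]

/-- A Carathéodory solution of an autonomous equation is an integral curve. -/
lemma isMIntegralCurveOn_of_absolutelyContinuous {Z : (x : M) → TangentSpace I x}
    (hZ : ContMDiff I I.tangent 1 (fun x => (⟨x, Z x⟩ : TangentBundle I M)))
    {γ : ℝ → M} {a b : ℝ} (hc : ContinuousOn γ (Ioo a b))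
    (hac : ∀ f : M → ℝ, ContMDiff I 𝓘(ℝ, ℝ) ∞ f → ∀ c d : ℝ, uIcc c d ⊆ Ioo a b →
      AbsolutelyContinuousOnInterval (fun t => f (γ t)) c d)
    (hd : ∀ᵐ t : ℝ, t ∈ Ioo a b →
      HasMFDerivAt 𝓘(ℝ, ℝ) I γ t ((1 : ℝ →L[ℝ] ℝ).smulRight (Z (γ t)))) :
    IsMIntegralCurveOn (I := I) γ Z (Ioo a b) := by
  intro t₀ ht₀
  refine HasMFDerivAt.hasMFDerivWithinAt ?_
  have hct : ContinuousAt γ t₀ := hc.continuousAt (isOpen_Ioo.mem_nhds ht₀)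
  set p := γ t₀
  let ρ : SmoothBumpFunction I p := Classical.arbitrary _
  have e1 : ∀ᶠ q in 𝓝 p, ρ q = 1 := ρ.eventuallyEq_one
  have e2 : ∀ᶠ q in 𝓝 p, q ∈ (chartAt H p).source := chart_source_mem_nhds H p
  have e3 : ∀ᶠ q in 𝓝 p, ContinuousAt (chartField p Z) (extChartAt I p q) :=
    (continuousAt_extChartAt p).eventually
      (((contDiffAt_chartField (hZ p)).eventually (by norm_num)).mono
        fun y hy => hy.continuousAt)
  have e4 := (hct.eventually (e1.and (e2.and e3))).and (isOpen_Ioo.mem_nhds ht₀)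
  obtain ⟨δ, hδ, hδ'⟩ := nhds_basis_Icc_pos t₀ |>.mem_iff.1 e4
  have hsrc : ∀ t ∈ Icc (t₀ - δ) (t₀ + δ), γ t ∈ (chartAt H p).source :=
    fun t ht => (hδ' ht).1.2.1
  have hcont : ContinuousOn (fun t => extChartAt I p (γ t)) (Icc (t₀ - δ) (t₀ + δ)) := by
    intro t ht
    have h1 : ContinuousAt γ t := hc.continuousAt (isOpen_Ioo.mem_nhds (hδ' ht).2)
    exact ((continuousAt_extChartAt' (by rw [extChartAt_source]; exact hsrc t ht)).comp
      h1).continuousWithinAt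
  have hK : ContinuousOn (fun t => chartField p Z (extChartAt I p (γ t)))
      (Icc (t₀ - δ) (t₀ + δ)) := fun t ht =>
    ContinuousAt.comp_continuousWithinAt (f := fun t => extChartAt I p (γ t))
      (hδ' ht).1.2.2 (hcont t ht)
  have hsub : Icc (t₀ - δ) (t₀ + δ) ⊆ Ioo a b := fun t ht => (hδ' ht).2
  have huIcc : uIcc (t₀ - δ) (t₀ + δ) = Icc (t₀ - δ) (t₀ + δ) := uIcc_of_le (by linarith)
  have h1 : HasDerivAt (extChartAt I p ∘ γ) (chartField p Z (extChartAt I p (γ t₀))) t₀ := by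
    refine hasDerivAt_of_absolutelyContinuous (c := t₀ - δ) (d := t₀ + δ)
      ⟨by linarith, by linarith⟩ hK (fun l => ?_) ?_
    · have hf : ContMDiff I 𝓘(ℝ, ℝ) ∞ (fun q => ρ q • l (extChartAt I p q)) :=
        ρ.contMDiff_smul (l.contMDiff.comp_contMDiffOn contMDiffOn_extChartAt)
      refine absolutelyContinuousOnInterval_congr (hac _ hf (t₀ - δ) (t₀ + δ) (huIcc ▸ hsub)) ?_
      intro t ht
      have h2 : ρ (γ t) = 1 := (hδ' (huIcc ▸ ht)).1.1
      change ρ (γ t) • l (extChartAt I p (γ t)) = l (extChartAt I p (γ t))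
      rw [h2, one_smul]
    · filter_upwards [hd] with t ht htI
      have ht' := Ioo_subset_Icc_self htI
      have h2 := hasDerivAt_extChartAt_comp (ht (hsub ht')) (hsrc t ht')
      rwa [← chartField_extChartAt p Z (hsrc t ht')] at h2
  have hp : γ t₀ ∈ (chartAt H p).source := mem_chart_source H p
  rw [chartField_extChartAt p Z hp] at h1
  exact hasMFDerivAt_of_extChartAt_comp hct hp h1

/-- A Carathéodory solution follows the flow, up to the endpoints of its interval of definition. -/
lemma IsFlow.eq_of_absolutelyContinuous {Z : (x : M) → TangentSpace I x} {Φ : ℝ → M → M}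
    (hΦ : IsFlow I Z Φ)
    (hZ : ContMDiff I I.tangent 1 (fun x => (⟨x, Z x⟩ : TangentBundle I M)))
    {γ : ℝ → M} {a b : ℝ} (hc : ContinuousOn γ (uIcc a b))
    (hac : ∀ f : M → ℝ, ContMDiff I 𝓘(ℝ, ℝ) ∞ f → ∀ c d : ℝ, uIcc c d ⊆ uIcc a b →
      AbsolutelyContinuousOnInterval (fun t => f (γ t)) c d)
    (hd : ∀ᵐ t : ℝ, t ∈ uIoo a b →
      HasMFDerivAt 𝓘(ℝ, ℝ) I γ t ((1 : ℝ →L[ℝ] ℝ).smulRight (Z (γ t)))) :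
    γ b = Φ (b - a) (γ a) := by
  wlog hab : a ≤ b generalizing a b
  · have h := this (by rwa [uIcc_comm]) (by rwa [uIcc_comm]) (by rwa [uIoo_comm]) (le_of_not_ge hab)
    rw [h, ← hΦ.map_add hZ, sub_add_sub_cancel, sub_self, hΦ.map_zero]
  rcases hab.eq_or_lt with rfl | hab
  · rw [sub_self, hΦ.map_zero]
  rw [uIcc_of_le hab.le] at hc hac
  rw [uIoo_of_lt hab] at hd
  have hγ := isMIntegralCurveOn_of_absolutelyContinuous hZ (hc.mono Ioo_subset_Icc_self)
    (fun f hf c d hcd => hac f hf c d (hcd.trans Ioo_subset_Icc_self)) hd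
  obtain ⟨t₀, ht₀⟩ := nonempty_Ioo.2 hab
  have hΦt : IsMIntegralCurve (I := I) (fun t => Φ (t - t₀) (γ t₀)) Z :=
    (hΦ.isMIntegralCurve (γ t₀)).comp_add (-t₀)
  have heq : EqOn γ (fun t => Φ (t - t₀) (γ t₀)) (Ioo a b) :=
    isMIntegralCurveOn_Ioo_eqOn_of_contMDiff_boundaryless ht₀ hZ hγ (hΦt.isMIntegralCurveOn _)
      (by simp only [sub_self, hΦ.map_zero])
  have heq' : EqOn γ (fun t => Φ (t - t₀) (γ t₀)) (Icc a b) :=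
    heq.of_subset_closure hc hΦt.continuous.continuousOn Ioo_subset_Icc_self
      (by rw [closure_Ioo hab.ne])
  have hb := heq' (right_mem_Icc.2 hab.le)
  have ha := heq' (left_mem_Icc.2 hab.le)
  simp only at ha hb
  rw [hb, ha, ← hΦ.map_add hZ, sub_add_sub_cancel]

end Caratheodory

section Regularity

variable {E : Type*} [NormedAddCommGroup E] [NormedSpace ℝ E]
  {H : Type*} [TopologicalSpace H] {I : ModelWithCorners ℝ E H} [I.Boundaryless]
  {M : Type*} [TopologicalSpace M] [ChartedSpace H M] [IsManifold I 1 M]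

/-- A smooth function is continuously differentiable along the integral curves of a `C¹` vector
field. -/
lemma IsMIntegralCurve.contDiff_comp {Z : (x : M) → TangentSpace I x}
    (hZ : ContMDiff I I.tangent 1 (fun x => (⟨x, Z x⟩ : TangentBundle I M))) {γ : ℝ → M}
    (hγ : IsMIntegralCurve (I := I) γ Z) {f : M → ℝ} (hf : ContMDiff I 𝓘(ℝ, ℝ) 1 f) :
    ContDiff ℝ 1 (fun t => f (γ t)) := by
  rw [contDiff_iff_contDiffAt]
  intro t₀
  set p := γ t₀
  have hc := hγ.continuous
  have e1 : ∀ᶠ q in 𝓝 p, q ∈ (chartAt H p).source := chart_source_mem_nhds H p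
  have e2 : ∀ᶠ q in 𝓝 p, ContinuousAt (chartField p Z) (extChartAt I p q) :=
    (continuousAt_extChartAt p).eventually
      (((contDiffAt_chartField (hZ p)).eventually (by norm_num)).mono
        fun y hy => hy.continuousAt)
  have hev := hc.continuousAt.eventually (e1.and e2)
  have h1 : ContDiffAt ℝ 1 (extChartAt I p ∘ γ) t₀ := by
    rw [contDiffAt_one_iff]
    refine ⟨fun t => (1 : ℝ →L[ℝ] ℝ).smulRight (chartField p Z (extChartAt I p (γ t))), _, hev,
      fun t ht => ?_, fun t ht => ?_⟩
    · have h2 : ContinuousAt (fun t => extChartAt I p (γ t)) t :=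
        (continuousAt_extChartAt' (by rw [extChartAt_source]; exact ht.1)).comp hc.continuousAt
      have h3 : ContinuousAt (fun t => chartField p Z (extChartAt I p (γ t))) t :=
        ContinuousAt.comp (f := fun t => extChartAt I p (γ t)) ht.2 h2
      exact (((ContinuousLinearMap.smulRightL ℝ ℝ E 1).continuous.continuousAt).comp
        h3).continuousWithinAt
    · have h2 := hasDerivAt_extChartAt_comp (hγ t) ht.1
      rw [← chartField_extChartAt p Z ht.1] at h2
      simp only [ContinuousLinearMap.smulRight_one_eq_toSpanSingleton]
      exact h2.hasFDerivAt
  have h2 : ContDiffAt ℝ 1 (f ∘ (extChartAt I p).symm) ((extChartAt I p ∘ γ) t₀) := by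
    have h3 : ContMDiffAt 𝓘(ℝ, E) I 1 (extChartAt I p).symm (extChartAt I p p) :=
      (contMDiffOn_extChartAt_symm (I := I) p).contMDiffAt (extChartAt_target_mem_nhds p)
    have h4 := (hf ((extChartAt I p).symm (extChartAt I p p))).comp _ h3
    exact h4.contDiffAt
  refine (h2.comp t₀ h1).congr_of_eventuallyEq ?_
  filter_upwards [hev] with t ht
  exact congrArg f ((extChartAt I p).left_inv (by rw [extChartAt_source]; exact ht.1)).symm

/-- A function that is continuously differentiable on both sides of every point is absolutely
continuous. -/
lemma absolutelyContinuousOnInterval_of_contDiff_sides {h : ℝ → ℝ}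
    (hh : ∀ s, ∃ δ > 0, ∃ h₁ h₂ : ℝ → ℝ, ContDiff ℝ 1 h₁ ∧ ContDiff ℝ 1 h₂ ∧
      EqOn h h₁ (Ioc (s - δ) s) ∧ EqOn h h₂ (Ico s (s + δ))) (a b : ℝ) :
    AbsolutelyContinuousOnInterval h a b := by
  suffices hloc : LocallyLipschitzOn (uIcc a b) h by
    obtain ⟨K, hK⟩ := hloc.exists_lipschitzOnWith_of_compact isCompact_uIcc
    exact hK.absolutelyContinuousOnInterval
  intro s _
  obtain ⟨δ, hδ, h₁, h₂, hc₁, hc₂, he₁, he₂⟩ := hh s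
  obtain ⟨K₁, U₁, hU₁, hK₁⟩ := hc₁.contDiffAt.exists_lipschitzOnWith (x := s)
  obtain ⟨K₂, U₂, hU₂, hK₂⟩ := hc₂.contDiffAt.exists_lipschitzOnWith (x := s)
  have hV : U₁ ∩ U₂ ∩ Ioo (s - δ) (s + δ) ∈ 𝓝 s :=
    inter_mem (inter_mem hU₁ hU₂) (Ioo_mem_nhds (by linarith) (by linarith))
  refine ⟨max K₁ K₂, _, mem_nhdsWithin_of_mem_nhds hV, LipschitzOnWith.of_dist_le_mul ?_⟩
  have hsV := mem_of_mem_nhds hV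
  have hleft : ∀ x ∈ U₁ ∩ U₂ ∩ Ioo (s - δ) (s + δ), ∀ y ∈ U₁ ∩ U₂ ∩ Ioo (s - δ) (s + δ),
      x ≤ s → y ≤ s → dist (h x) (h y) ≤ (max K₁ K₂ : NNReal) * dist x y := by
    intro x hx y hy hxs hys
    rw [he₁ ⟨hx.2.1, hxs⟩, he₁ ⟨hy.2.1, hys⟩]
    refine (hK₁.dist_le_mul x hx.1.1 y hy.1.1).trans ?_
    gcongr
    exact le_max_left _ _
  have hright : ∀ x ∈ U₁ ∩ U₂ ∩ Ioo (s - δ) (s + δ), ∀ y ∈ U₁ ∩ U₂ ∩ Ioo (s - δ) (s + δ),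
      s ≤ x → s ≤ y → dist (h x) (h y) ≤ (max K₁ K₂ : NNReal) * dist x y := by
    intro x hx y hy hxs hys
    rw [he₂ ⟨hxs, hx.2.2⟩, he₂ ⟨hys, hy.2.2⟩]
    refine (hK₂.dist_le_mul x hx.1.2 y hy.1.2).trans ?_
    gcongr
    exact le_max_right _ _
  have hmid : ∀ x ∈ U₁ ∩ U₂ ∩ Ioo (s - δ) (s + δ), ∀ y ∈ U₁ ∩ U₂ ∩ Ioo (s - δ) (s + δ),
      x ≤ s → s ≤ y → dist (h x) (h y) ≤ (max K₁ K₂ : NNReal) * dist x y := by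
    intro x hx y hy hxs hys
    refine (dist_triangle _ (h s) _).trans ?_
    refine (add_le_add (hleft x hx s hsV hxs le_rfl) (hright s hsV y hy le_rfl hys)).trans ?_
    rw [← mul_add]
    gcongr
    rw [Real.dist_eq, Real.dist_eq, Real.dist_eq, abs_of_nonpos (by linarith),
      abs_of_nonpos (by linarith), abs_of_nonpos (by linarith)]
    linarith
  intro x hx y hy
  rcases le_total x s with hxs | hxs <;> rcases le_total y s with hys | hys
  · exact hleft x hx y hy hxs hys
  · exact hmid x hx y hy hxs hys
  · rw [dist_comm, dist_comm x y]
    exact hmid y hy x hx hys hxs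
  · exact hright x hx y hy hxs hys

end Regularity

section SwitchingTimes

lemma exists_disjoint_Ioo {S : Set ℝ} (hS : ∀ a b : ℝ, (S ∩ Icc a b).Finite) (s : ℝ) :
    ∃ δ > 0, Disjoint (Ioo (s - δ) (s + δ) \ {s}) S := by
  have hfin : ((S ∩ Icc (s - 1) (s + 1)) \ {s}).Finite := (hS _ _).subset sdiff_subset
  have hV : ((S ∩ Icc (s - 1) (s + 1)) \ {s})ᶜ ∩ Icc (s - 1) (s + 1) ∈ 𝓝 s :=
    inter_mem (hfin.isClosed.isOpen_compl.mem_nhds (by simp))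
      (Icc_mem_nhds (by linarith) (by linarith))
  obtain ⟨δ, hδ, hδ'⟩ := (nhds_basis_Ioo_pos s).mem_iff.1 hV
  refine ⟨δ, hδ, Set.disjoint_left.2 fun x hx hxS => ?_⟩
  obtain ⟨h1, h2⟩ := hδ' hx.1
  exact h1 ⟨⟨hxS, h2⟩, hx.2⟩

/-- A property of times that propagates in both directions along intervals without switching times
holds at all times. -/
lemma forall_of_propagates {S : Set ℝ} (hS : ∀ a b : ℝ, (S ∩ Icc a b).Finite) {P : ℝ → Prop}
    (hP : ∀ a b, Disjoint (uIoo a b) S → P a → P b) {t₀ : ℝ} (h₀ : P t₀) (t : ℝ) : P t := by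
  have hloc : ∀ s, ∀ᶠ t in 𝓝 s, Disjoint (uIoo s t) S := by
    intro s
    obtain ⟨δ, hδ, h⟩ := exists_disjoint_Ioo hS s
    filter_upwards [Ioo_mem_nhds (show s - δ < s by linarith) (show s < s + δ by linarith)]
      with t ht
    refine h.mono_left fun x hx => ?_
    rcases lt_trichotomy s t with hst | rfl | hst
    · rw [uIoo_of_lt hst] at hx
      exact ⟨⟨by linarith [hx.1], hx.2.trans ht.2⟩, hx.1.ne'⟩
    · simp at hx
    · rw [uIoo_of_gt hst] at hx
      exact ⟨⟨ht.1.trans hx.1, by linarith [hx.2]⟩, hx.2.ne⟩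
  have hclopen : IsClopen {t | P t} := by
    constructor
    · rw [← isOpen_compl_iff, isOpen_iff_mem_nhds]
      intro s hs
      filter_upwards [hloc s] with t ht hPt
      exact hs (hP t s (by rwa [uIoo_comm]) hPt)
    · rw [isOpen_iff_mem_nhds]
      intro s hs
      filter_upwards [hloc s] with t ht
      exact hP s t ht hs
  have : t ∈ {t | P t} := by
    rw [hclopen.eq_univ ⟨t₀, h₀⟩]
    trivial
  exact this

lemma exists_pred {S : Set ℝ} (hS : ∀ a b : ℝ, (S ∩ Icc a b).Finite) (h0 : (0 : ℝ) ∈ S) {t : ℝ}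
    (ht : t ≠ 0) : ∃ p ∈ S, p ∈ uIcc 0 t ∧ p ≠ t ∧ Disjoint (uIoo p t) S := by
  rcases lt_or_gt_of_ne ht with ht | ht
  · have hfin : (S ∩ Ioc t 0).Finite :=
      (hS t 0).subset (inter_subset_inter_right _ Ioc_subset_Icc_self)
    obtain ⟨p, ⟨hpS, hp⟩, hmin⟩ := Set.exists_min_image _ id hfin ⟨0, h0, ht, le_rfl⟩
    refine ⟨p, hpS, by rw [uIcc_of_ge ht.le]; exact ⟨hp.1.le, hp.2⟩, hp.1.ne', ?_⟩
    rw [uIoo_of_gt hp.1, Set.disjoint_left]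
    intro x hx hxS
    exact absurd (hmin x ⟨hxS, hx.1, hx.2.le.trans hp.2⟩) (not_le.2 hx.2)
  · have hfin : (S ∩ Ico 0 t).Finite :=
      (hS 0 t).subset (inter_subset_inter_right _ Ico_subset_Icc_self)
    obtain ⟨p, ⟨hpS, hp⟩, hmax⟩ := Set.exists_max_image _ id hfin ⟨0, h0, le_rfl, ht⟩
    refine ⟨p, hpS, by rw [uIcc_of_le ht.le]; exact ⟨hp.1, hp.2.le⟩, hp.2.ne, ?_⟩
    rw [uIoo_of_lt hp.2, Set.disjoint_left]
    intro x hx hxS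
    exact absurd (hmax x ⟨hxS, hp.1.trans hx.1.le, hx.2⟩) (not_le.2 hx.1)

/-- Recursion on the number of switching times between `0` and `t`. -/
lemma exists_recursion {M : Type*} {S : Set ℝ} (hS : ∀ a b : ℝ, (S ∩ Icc a b).Finite)
    {p : ℝ → ℝ} (hp : ∀ t ≠ 0, p t ∈ S ∧ p t ∈ uIcc 0 t ∧ p t ≠ t) (step : ℝ → M → M) (g : M) :
    ∃ F : ℝ → M, F 0 = g ∧ ∀ t ≠ 0, F t = step t (F (p t)) := by
  classical
  let N : ℝ → ℕ := fun t => ((S ∩ uIcc 0 t) \ {t}).ncard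
  have hN : ∀ t ≠ 0, N (p t) < N t := by
    intro t ht
    obtain ⟨h1, h2, h3⟩ := hp t ht
    refine Set.ncard_lt_ncard ⟨?_, fun h => ?_⟩ ((hS _ _).subset sdiff_subset)
    · rintro x ⟨⟨hxS, hx⟩, hne⟩
      refine ⟨⟨hxS, uIcc_subset_uIcc_left h2 hx⟩, ?_⟩
      rintro rfl
      refine hne ?_
      rcases le_total 0 x with h | h
      · rw [uIcc_of_le h] at h2
        rw [uIcc_of_le h2.1] at hx
        exact le_antisymm hx.2 h2.2
      · rw [uIcc_of_ge h] at h2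
        rw [uIcc_of_ge h2.2] at hx
        exact le_antisymm h2.1 hx.1
    · exact (h ⟨⟨h1, h2⟩, h3⟩).2 rfl
  let wf : WellFounded (InvImage (· < ·) N) := (measure N).wf
  let F : ℝ → M := wf.fix fun t ih => if h : t = 0 then g else step t (ih (p t) (hN t h))
  refine ⟨F, ?_, fun t ht => ?_⟩
  · exact (wf.fix_eq _ 0).trans (dif_pos rfl)
  · exact (wf.fix_eq _ t).trans (dif_neg ht)

lemma mem_uIoo_iff {a b x : ℝ} : x ∈ uIoo a b ↔ a < x ∧ x < b ∨ b < x ∧ x < a := by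
  rw [uIoo_eq_union]
  rfl

/-- Concatenation of the flows of a piecewise constant control. -/
lemma exists_trajectory {M V : Type*} {S : Set ℝ} (hS : ∀ a b : ℝ, (S ∩ Icc a b).Finite)
    (h0 : (0 : ℝ) ∈ S) {u : ℝ → V}
    (hu : ∀ a b, Disjoint (Ioo a b) S → ∃ v, ∀ r ∈ Ioo a b, u r = v)
    {Φ : V → ℝ → M → M} (hΦ0 : ∀ v x, Φ v 0 x = x)
    (hΦ : ∀ v s t x, Φ v (s + t) x = Φ v s (Φ v t x)) (g : M) :
    ∃ F : ℝ → M, F 0 = g ∧ ∀ a b v, Disjoint (uIoo a b) S → (∀ r ∈ uIoo a b, u r = v) →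
      F b = Φ v (b - a) (F a) := by
  have hpred : ∀ t : ℝ, ∃ p, t ≠ 0 → p ∈ S ∧ p ∈ uIcc 0 t ∧ p ≠ t ∧ Disjoint (uIoo p t) S := by
    intro t
    by_cases ht : t = 0
    · exact ⟨0, fun h => absurd ht h⟩
    · obtain ⟨p, hp⟩ := exists_pred hS h0 ht
      exact ⟨p, fun _ => hp⟩
  choose p hp using hpred
  obtain ⟨F, hF0, hF⟩ := exists_recursion hS
    (fun t ht => ⟨(hp t ht).1, (hp t ht).2.1, (hp t ht).2.2.1⟩)
    (fun t x => Φ (u ((p t + t) / 2)) (t - p t) x) g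
  have hstep : ∀ t ≠ 0, ∀ s v, s ∈ uIoo (p t) t → u s = v → F t = Φ v (t - p t) (F (p t)) := by
    intro t ht s v hs hv
    obtain ⟨-, -, h3, h4⟩ := hp t ht
    have hmid : (p t + t) / 2 ∈ uIoo (p t) t := by
      rcases lt_or_gt_of_ne h3 with h | h
      · rw [uIoo_of_lt h]
        constructor <;> linarith
      · rw [uIoo_of_gt h]
        constructor <;> linarith
    obtain ⟨w, hw⟩ := hu _ _ h4
    rw [hF t ht, hw _ hmid, ← hv, ← hw _ hs]
  refine ⟨F, hF0, ?_⟩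
  have main : ∀ a b v, a ∈ uIcc 0 b → Disjoint (uIoo a b) S → (∀ r ∈ uIoo a b, u r = v) →
      F b = Φ v (b - a) (F a) := by
    intro a b v hab hd hv
    by_cases hne : a = b
    · subst hne
      rw [sub_self, hΦ0]
    have hb : b ≠ 0 := by
      rintro rfl
      rw [uIcc_self] at hab
      exact hne hab
    obtain ⟨s, hs⟩ : (uIoo a b).Nonempty := nonempty_uIoo.2 hne
    obtain ⟨hb1, hb2, hb3, hb4⟩ := hp b hb
    by_cases hpa : a = p b
    · have := hstep b hb s v (hpa ▸ hs) (hv s hs)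
      rwa [← hpa] at this
    have hqS : p b ∉ uIoo a b := fun h => Set.disjoint_left.1 hd h hb1
    rw [mem_uIcc] at hab hb2
    have hba : a ∈ uIoo (p b) b := by
      rw [mem_uIoo_iff] at hqS ⊢
      grind
    have haS : a ∉ S := fun h => Set.disjoint_left.1 hb4 hba h
    have ha : a ≠ 0 := fun h => haS (h ▸ h0)
    obtain ⟨ha1, ha2, ha3, ha4⟩ := hp a ha
    have hpp : p a = p b := by
      have h1 : p a ∉ uIoo (p b) b := fun h => Set.disjoint_left.1 hb4 h ha1
      have h2 : p b ∉ uIoo (p a) a := fun h => Set.disjoint_left.1 ha4 h hb1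
      rw [mem_uIoo_iff] at h1 h2 hba
      rw [mem_uIcc] at ha2
      grind
    have hsub : uIoo (p b) a ⊆ uIoo (p b) b := by
      intro x hx
      rw [mem_uIoo_iff] at hx hba ⊢
      grind
    have hsub' : uIoo a b ⊆ uIoo (p b) b := by
      intro x hx
      rw [mem_uIoo_iff] at hx hba ⊢
      grind
    obtain ⟨w, hw⟩ := hu _ _ hb4
    have hwv : w = v := (hw s (hsub' hs)).symm.trans (hv s hs)
    subst hwv
    obtain ⟨s', hs'⟩ : (uIoo (p a) a).Nonempty := nonempty_uIoo.2 ha3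
    rw [hstep b hb s w (hsub' hs) (hv s hs),
      hstep a ha s' w hs' (hw s' (hsub (hpp ▸ hs'))), ← hΦ, hpp, sub_add_sub_cancel]
  intro a b v hd hv
  by_cases hab : a ∈ uIcc 0 b
  · exact main a b v hab hd hv
  have hba : b ∈ uIcc 0 a := by
    have h1 : (0 : ℝ) ∉ uIoo a b := fun h => Set.disjoint_left.1 hd h h0
    rw [mem_uIoo_iff] at h1
    rw [mem_uIcc] at hab ⊢
    grind
  rw [main b a v hba (by rwa [uIoo_comm]) (by rwa [uIoo_comm]), ← hΦ, sub_add_sub_cancel, sub_self,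
    hΦ0]

end SwitchingTimes

section System

variable {E : Type*} [NormedAddCommGroup E] [NormedSpace ℝ E]
  {H : Type*} [TopologicalSpace H] {I : ModelWithCorners ℝ E H} [I.Boundaryless]
  {G : Type*} [TopologicalSpace G] [ChartedSpace H G] [IsManifold I ∞ G]
  {m : ℕ} {X Y : Fin (m + 1) → (g : G) → TangentSpace I g} {Φ : (Fin m → ℝ) → ℝ → G → G}

/-- A curve that follows the flows of the constant controls between the switching times is a
solution. -/
lemma isSolutionOn_of_trajectory
    (hZ : ∀ v, ContMDiff I I.tangent 1 (fun g => (⟨g, affineField X Y v g⟩ : TangentBundle I G)))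
    (hΦ : ∀ v, IsFlow I (affineField X Y v) (Φ v)) {S : Set ℝ}
    (hS : ∀ a b : ℝ, (S ∩ Icc a b).Finite) {u : ℝ → Fin m → ℝ}
    (hu : ∀ a b, Disjoint (Ioo a b) S → ∃ v, ∀ r ∈ Ioo a b, u r = v) {F : ℝ → G}
    (hF : ∀ a b v, Disjoint (uIoo a b) S → (∀ r ∈ uIoo a b, u r = v) →
      F b = Φ v (b - a) (F a)) : IsSolutionOn X Y u F univ := by
  have hcurve : ∀ v s g, IsMIntegralCurve (I := I) (fun t => Φ v (t - s) g) (affineField X Y v) :=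
    fun v s g => ((hΦ v).isMIntegralCurve g).comp_add (-s)
  have hside : ∀ s, ∃ δ > 0, ∃ v₁ v₂, EqOn F (fun t => Φ v₁ (t - s) (F s)) (Ioc (s - δ) s) ∧
      EqOn F (fun t => Φ v₂ (t - s) (F s)) (Ico s (s + δ)) := by
    intro s
    obtain ⟨δ, hδ, hd⟩ := exists_disjoint_Ioo hS s
    have hd₁ : Disjoint (Ioo (s - δ) s) S := hd.mono_left
      (show Ioo (s - δ) s ⊆ Ioo (s - δ) (s + δ) \ {s} from
        fun x hx => ⟨⟨hx.1, by linarith [hx.2]⟩, hx.2.ne⟩)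
    have hd₂ : Disjoint (Ioo s (s + δ)) S := hd.mono_left
      (show Ioo s (s + δ) ⊆ Ioo (s - δ) (s + δ) \ {s} from
        fun x hx => ⟨⟨by linarith [hx.1], hx.2⟩, hx.1.ne'⟩)
    obtain ⟨v₁, hv₁⟩ := hu _ _ hd₁
    obtain ⟨v₂, hv₂⟩ := hu _ _ hd₂
    refine ⟨δ, hδ, v₁, v₂, fun t ht => ?_, fun t ht => ?_⟩
    · have hsub : uIoo s t ⊆ Ioo (s - δ) s := by
        rw [uIoo_of_ge ht.2]
        exact Ioo_subset_Ioo_left ht.1.le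
      exact hF s t v₁ (hd₁.mono_left hsub) fun r hr => hv₁ r (hsub hr)
    · have hsub : uIoo s t ⊆ Ioo s (s + δ) := by
        rw [uIoo_of_le ht.1]
        exact Ioo_subset_Ioo_right ht.2.le
      exact hF s t v₂ (hd₂.mono_left hsub) fun r hr => hv₂ r (hsub hr)
  have hcont : Continuous F := by
    rw [continuous_iff_continuousAt]
    intro s
    obtain ⟨δ, hδ, v₁, v₂, h₁, h₂⟩ := hside s
    rw [continuousAt_iff_continuous_left_right]
    constructor
    · refine ((hcurve v₁ s (F s)).continuous.continuousWithinAt).congr_of_eventuallyEq ?_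
        (h₁ ⟨by linarith, le_rfl⟩)
      filter_upwards [Ioc_mem_nhdsLE (show s - δ < s by linarith)] with t ht using h₁ ht
    · refine ((hcurve v₂ s (F s)).continuous.continuousWithinAt).congr_of_eventuallyEq ?_
        (h₂ ⟨le_rfl, by linarith⟩)
      filter_upwards [Ico_mem_nhdsGE (show s < s + δ by linarith)] with t ht using h₂ ht
  refine ⟨hcont.continuousOn, fun f hf a b _ => ?_, ?_⟩
  · refine absolutelyContinuousOnInterval_of_contDiff_sides (fun s => ?_) a b
    obtain ⟨δ, hδ, v₁, v₂, h₁, h₂⟩ := hside s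
    have hf1 : ContMDiff I 𝓘(ℝ, ℝ) 1 f := hf.of_le (by norm_cast)
    exact ⟨δ, hδ, _, _, IsMIntegralCurve.contDiff_comp (hZ v₁) (hcurve v₁ s (F s)) hf1,
      IsMIntegralCurve.contDiff_comp (hZ v₂) (hcurve v₂ s (F s)) hf1,
      fun t ht => congrArg f (h₁ ht), fun t ht => congrArg f (h₂ ht)⟩
  · have hcount : S.Countable := by
      have : S = ⋃ n : ℕ, S ∩ Icc (-n : ℝ) n := by
        rw [← inter_iUnion, eq_comm, inter_eq_left]
        intro x _
        obtain ⟨n, hn⟩ := exists_nat_ge |x|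
        exact mem_iUnion.2 ⟨n, abs_le.1 hn⟩
      rw [this]
      exact countable_iUnion fun n => (hS _ _).countable
    filter_upwards [hcount.ae_notMem volume] with s hs _
    obtain ⟨δ, hδ, hd⟩ := exists_disjoint_Ioo hS s
    have hd' : Disjoint (Ioo (s - δ) (s + δ)) S := by
      rw [Set.disjoint_left] at hd ⊢
      intro x hx hxS
      by_cases hxs : x = s
      · exact hs (hxs ▸ hxS)
      · exact hd ⟨hx, hxs⟩ hxS
    obtain ⟨v, hv⟩ := hu _ _ hd'
    have hsI : s ∈ Ioo (s - δ) (s + δ) := ⟨by linarith, by linarith⟩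
    have hev : F =ᶠ[𝓝 s] fun t => Φ v (t - s) (F s) := by
      filter_upwards [isOpen_Ioo.mem_nhds hsI] with t ht
      have hsub : uIoo s t ⊆ Ioo (s - δ) (s + δ) :=
        uIoo_subset_Ioo (Ioo_subset_Icc_self hsI) (Ioo_subset_Icc_self ht)
      exact hF s t v (hd'.mono_left hsub) fun r hr => hv r (hsub hr)
    have h1 := (hcurve v s (F s) s).congr_of_eventuallyEq hev
    rw [hv s hsI]
    obtain ⟨w, hw⟩ : ∃ w : E, w = affineField X Y v (F s) := ⟨_, rfl⟩
    have h2 : w = affineField X Y v (Φ v (s - s) (F s)) :=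
      hw.trans (field_congr (affineField X Y v) hev.eq_of_nhds)
    have h3 : HasMFDerivAt 𝓘(ℝ, ℝ) I F s ((1 : ℝ →L[ℝ] ℝ).smulRight w) := by
      rw [h2]
      exact h1
    exact hw ▸ h3

lemma IsSolutionOn.eq_flow [FiniteDimensional ℝ E] [T2Space G]
    (hZ : ∀ v, ContMDiff I I.tangent 1 (fun g => (⟨g, affineField X Y v g⟩ : TangentBundle I G)))
    (hΦ : ∀ v, IsFlow I (affineField X Y v) (Φ v)) {u : ℝ → Fin m → ℝ} {J : Set ℝ} {γ : ℝ → G}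
    (hγ : IsSolutionOn X Y u γ J) {a t : ℝ} {v : Fin m → ℝ} (hJ : uIcc a t ⊆ J)
    (hu : ∀ r ∈ uIoo a t, u r = v) : γ t = Φ v (t - a) (γ a) := by
  refine (hΦ v).eq_of_absolutelyContinuous (hZ v) (hγ.continuousOn.mono hJ)
    (fun f hf c d hcd => hγ.absolutelyContinuous f hf c d (hcd.trans hJ)) ?_
  filter_upwards [hγ.hasDeriv] with s hs hst
  have h1 : s ∈ interior J :=
    mem_interior.2 ⟨uIoo a t, uIoo_subset_uIcc_self.trans hJ, isOpen_Ioo, hst⟩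
  have h2 := hs h1
  rwa [hu s hst] at h2

lemma existsUnique_isSolutionOn_of_isPiecewiseConstant [FiniteDimensional ℝ E] [T2Space G]
    (hZ : ∀ v, ContMDiff I I.tangent 1 (fun g => (⟨g, affineField X Y v g⟩ : TangentBundle I G)))
    (hΦ : ∀ v, IsFlow I (affineField X Y v) (Φ v)) {u : ℝ → Fin m → ℝ}
    (hu : IsPiecewiseConstant u) (g : G) :
    ∃! γ : ℝ → G, IsSolutionOn X Y u γ univ ∧ γ 0 = g := by
  obtain ⟨S, hS, hu⟩ := hu
  have hS' : ∀ a b : ℝ, (insert 0 S ∩ Icc a b).Finite := fun a b =>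
    ((hS a b).insert 0).subset fun x hx => hx.1.imp id fun h => ⟨h, hx.2⟩
  have hu' : ∀ a b : ℝ, Disjoint (Ioo a b) (insert 0 S) → ∃ v, ∀ r ∈ Ioo a b, u r = v :=
    fun a b h => hu a b (h.mono_right (subset_insert _ _))
  obtain ⟨F, hF0, hF⟩ := exists_trajectory hS' (mem_insert _ _) hu'
    (fun v => (hΦ v).map_zero) (fun v => (hΦ v).map_add (hZ v)) g
  refine ⟨F, ⟨isSolutionOn_of_trajectory hZ hΦ hS' hu' hF, hF0⟩, ?_⟩
  rintro γ ⟨hγ, hγ0⟩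
  ext t
  refine forall_of_propagates hS' (P := fun t => γ t = F t) (fun a b hd hab => ?_)
    (hγ0.trans hF0.symm) t
  obtain ⟨v, hv⟩ := hu' _ _ hd
  rw [hγ.eq_flow hZ hΦ (subset_univ _) hv, hF a b v hd hv, hab]

end System

end AffineControl

end

theorem corollary2p5
    {E : Type*} [NormedAddCommGroup E] [NormedSpace ℝ E] [FiniteDimensional ℝ E]
    {H : Type*} [TopologicalSpace H] (I : ModelWithCorners ℝ E H) [I.Boundaryless]
    {G : Type*} [TopologicalSpace G] [ChartedSpace H G] [Group G] [LieGroup I ∞ G]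
    [T2Space G] [ConnectedSpace G]
    (m : ℕ) (X Y : Fin (m + 1) → (g : G) → TangentSpace I g)
    (hX : ∀ i, AffineControl.IsLinearVectorField I (X i))
    (hY : ∀ i, AffineControl.IsRightInvariant I (Y i))
    (hcomm : ∀ i j, ∀ g : G, VectorField.mlieBracket I (X i) (X j) g = 0)
    (φ : Fin (m + 1) → ℝ → G → G) (hφ : ∀ i, AffineControl.IsFlow I (X i) (φ i)) :
    -- `Φ v t g` is the value at time `t` of the solution from `g` for the constant control `v`
    ∃ Φ : (Fin m → ℝ) → ℝ → G → G,
      -- existence: it is defined for all times, and a classical solution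
      (∀ v, AffineControl.IsFlow I (AffineControl.affineField X Y v) (Φ v)) ∧
      (∀ v g, AffineControl.IsSolutionOn X Y (fun _ => v) (fun t => Φ v t g) univ) ∧
      -- uniqueness, on every interval of times around 0
      (∀ v (J : Set ℝ) (γ : ℝ → G), J.OrdConnected → (0 : ℝ) ∈ J →
        AffineControl.IsSolutionOn X Y (fun _ => v) γ J → ∀ t ∈ J, γ t = Φ v t (γ 0)) ∧
      -- the formula for constant controls
      (∀ v t g, Φ v t g = Φ v t 1 * AffineControl.rho φ (AffineControl.timeVec v t) g) ∧
      -- piecewise constant controls: existence and uniqueness of the solution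
      (∀ u : ℝ → Fin m → ℝ, AffineControl.IsPiecewiseConstant u → ∀ g : G,
        ∃! γ : ℝ → G, AffineControl.IsSolutionOn X Y u γ univ ∧ γ 0 = g) ∧
      -- the formula for the solution on an interval where the control is constant
      (∀ (u : ℝ → Fin m → ℝ) (J : Set ℝ) (γ : ℝ → G), AffineControl.IsSolutionOn X Y u γ J →
        ∀ (a t : ℝ) (v : Fin m → ℝ), uIcc a t ⊆ J → (∀ r ∈ uIoo a t, u r = v) →
          γ t = Φ v (t - a) (γ a) ∧
          γ t = Φ v (t - a) 1 *
            AffineControl.rho φ (AffineControl.timeVec v (t - a)) (γ a)) := by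
  have hZ := AffineControl.contMDiff_affineField hX hY
  choose Φ hΦ hformula using AffineControl.exists_isFlow_affineField hX hY hcomm hφ
  refine ⟨Φ, hΦ, fun v g => ?_, fun v J γ hJ h0 hγ t ht => ?_, hformula,
    fun u hu g => AffineControl.existsUnique_isSolutionOn_of_isPiecewiseConstant hZ hΦ hu g,
    fun u J γ hγ a t v hJ hu => ?_⟩
  · refine AffineControl.isSolutionOn_of_trajectory (S := ∅) hZ hΦ (by simp)
      (fun _ _ _ => ⟨v, fun _ _ => rfl⟩) fun a b w _ hw => ?_
    by_cases hab : a = b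
    · subst hab
      rw [sub_self, (hΦ w).map_zero]
    · obtain ⟨r, hr⟩ := nonempty_uIoo.2 hab
      obtain rfl : v = w := hw r hr
      rw [← (hΦ v).map_add (hZ v), sub_add_cancel]
  · have h := hγ.eq_flow hZ hΦ (hJ.uIcc_subset h0 ht) (fun _ _ => rfl)
    rwa [sub_zero] at h
  · have h := hγ.eq_flow hZ hΦ hJ hu
    exact ⟨h, h.trans (hformula v (t - a) (γ a))⟩
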